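/- Let $\alpha\in(0,\infty)$ and let $\mathcal M\subset\mathbb R^{n+1}$ be a smooth, compact, connected $n$-dimensional hypersurface without boundary, equipped with the metric $h$ induced by the Euclidean metric of $\mathbb R^{n+1}$. Let $x:\mathcal M\times[0,T)\to\mathbb R^{n+1}$ be a time-dependent embedding of class $C^2$ that moves by mean curvature flow, $$\frac{\partial}{\partial t}x=-(H\nu)\circ x ,$$ where $\nu$ is a unit normal field on $x(\mathcal M,t)$ and $H$ is the mean curvature (the sum of the principal curvatures, positive for a round sphere with outward normal). Let $\psi_\alpha:\mathcal M\times[0,T)\to\mathcal M$ be a family of diffeomorphisms (of class $C^2$ on $\mathcal M\times[0,T)$, as is the family of its inverses) that solves the harmonic map heat flow $$\frac{\partial}{\partial t}\psi_\alpha=\frac1\alpha\,\Delta_{g(t),h}\psi_\alpha,\qquad \psi_\alpha(\cdot,0)=\mathrm{id},$$ where $g(t)$ is the metric on $\mathcal M$ induced by $x(t)$ and $\Delta_{g,h}$ is the map Laplacian, in local coordinates $(\Delta_{g,h}\psi)^q=g^{ij}\big(\partial_i\partial_j\Psi^q-\Gamma(g)^k_{ij}\partial_k\Psi^q+(\Gamma(h)^q_{mr}\circ\Psi)\,\partial_i\Psi^m\,\partial_j\Psi^r\big)$.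 (Time derivatives at $t=0$ are one-sided.) Let $\hat x_\alpha(t):=x(t)\circ\psi_\alpha(t)^{-1}$ be the mean curvature-DeTurck flow, $\Gamma(t):=\hat x_\alpha(\mathcal M,t)$, let $\nu$ be a unit normal field to $\Gamma(t)$, and let $\hat x_\alpha^{-1}(t):\Gamma(t)\to\mathcal M\subset\mathbb R^{n+1}$ be the inverse of $\hat x_\alpha(t)$. For a map $f:\Gamma(t)\to\mathbb R^{n+1}$ let $\nabla_{\Gamma(t)}f$ be the matrix whose $(\beta,\gamma)$ entry is the $\gamma$-th component of the tangential gradient of $f_\beta$ (understood in the weak sense for $f\in H^{1,2}(\Gamma(t),\mathbb R^{n+1})$), and write $A:B=\sum_{\beta,\gamma}A_{\beta\gamma}B_{\beta\gamma}$. Let $\Delta_{\hat g_\alpha(t)}$ be the Laplace operator, applied componentwise, of the metric $\hat g_\alpha(t)$ on $\mathcal M$ induced by $\hat x_\alpha(t)$, and put $$v_\alpha:=\Delta_{\hat g_\alpha(t)}\,\mathrm{id}_{\mathcal M},\qquad w_\alpha:=v_\alpha\circ\hat x_\alpha^{-1},\qquad \hat H_\alpha:=(\nabla_{\Gamma(t)}\hat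 x_\alpha^{-1})^T\,\nabla_{\Gamma(t)}\hat x_\alpha^{-1}+\nu\otimes\nu .$$ Let $u=\mathrm{id}_{\Gamma(t)}$, and let $\partial^\bullet u$ be its material derivative, defined by $(\partial^\bullet f)\circ\hat x_\alpha=\frac{\partial}{\partial t}(f\circ\hat x_\alpha)$, so that $\partial^\bullet u=\frac{\partial\hat x_\alpha}{\partial t}\circ\hat x_\alpha^{-1}$. Then for every $t\in[0,T)$ these quantities are well defined, $\hat H_\alpha$ is invertible at every point of $\Gamma(t)$, and, with $d\sigma$ the surface ($n$-dimensional Hausdorff) measure, $$0=\alpha\int_{\Gamma(t)}\partial^\bullet u\cdot\eta\,d\sigma+(1-\alpha)\int_{\Gamma(t)}(\partial^\bullet u\cdot\nu)(\nu\cdot\eta)\,d\sigma+\int_{\Gamma(t)}\nabla_{\Gamma(t)}u:\nabla_{\Gamma(t)}\eta\,d\sigma+\int_{\Gamma(t)}w_\alpha\cdot\big(\nabla_{\Gamma(t)}\hat x_\alpha^{-1}\,\hat H_\alpha^{-1}\,\eta\big)\,d\sigma,$$ $$0=\int_{\Gamma(t)}w_\alpha\cdot\zeta\,d\sigma+\int_{\Gamma(t)}\nabla_{\Gamma(t)}\hat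 x_\alpha^{-1}:\nabla_{\Gamma(t)}\zeta\,d\sigma$$ for all $\eta,\zeta\in H^{1,2}(\Gamma(t),\mathbb R^{n+1})$, all the integrands being integrable. -/

import Mathlib

open Set MeasureTheory
open scoped ContDiff Matrix

noncomputable section

/-- Euclidean space `ℝⁿ`, the parameter space of the local coordinates. -/
abbrev Coord (n : ℕ) : Type := EuclideanSpace ℝ (Fin n)

/-- The ambient Euclidean space `ℝⁿ⁺¹`. -/
abbrev Amb (n : ℕ) : Type := EuclideanSpace ℝ (Fin (n + 1))

/-! ### Hypersurfaces in `ℝⁿ⁺¹` -/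

/-- A local parametrization (inverse of a coordinate chart) of class `C^k` of the set
`M ⊆ ℝⁿ⁺¹`: a `C^k` immersion `map` of an open set `dom ⊆ ℝⁿ` which is a homeomorphism onto
a relatively open subset of `M`. -/
structure LocalParam (n : ℕ) (k : WithTop ℕ∞) (M : Set (Amb n)) where
  /-- the coordinate domain `Ω` -/
  dom : Set (Coord n)
  /-- the inverse chart `Ω → M` -/
  map : Coord n → Amb n
  isOpen_dom : IsOpen dom
  contDiffOn : ContDiffOn ℝ k map dom
  injective_fderiv : ∀ θ ∈ dom, Function.Injective (fderiv ℝ map θ)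
  injOn : InjOn map dom
  image_open : ∀ W ⊆ dom, IsOpen W → ∃ U : Set (Amb n), IsOpen U ∧ map '' W = M ∩ U

/-- The coordinate chart belonging to a local parametrization. -/
def LocalParam.chart {n : ℕ} {k : WithTop ℕ∞} {M : Set (Amb n)} (φ : LocalParam n k M) :
    Amb n → Coord n :=
  Function.invFunOn φ.map φ.dom

/-- `M` is an `n`-dimensional (embedded, boundaryless) hypersurface of class `C^k`. -/
def IsHypersurface (n : ℕ) (k : WithTop ℕ∞) (M : Set (Amb n)) : Prop :=
  ∀ p ∈ M, ∃ φ : LocalParam n k M, ∃ θ ∈ φ.dom, φ.map θ = p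

/-- `N` is a unit vector normal to the set `S` at `y` (orthogonal to the tangent space,
which for a hypersurface is the tangent cone). -/
def IsUnitNormalAt {n : ℕ} (S : Set (Amb n)) (y N : Amb n) : Prop :=
  ‖N‖ = 1 ∧ ∀ τ ∈ tangentConeAt ℝ S y, inner ℝ N τ = 0

/-! ### Riemannian geometry in local coordinates -/

/-- Partial derivative `∂F/∂θⁱ`. -/
def pd {n : ℕ} {W : Type*} [NormedAddCommGroup W] [NormedSpace ℝ W] (i : Fin n)
    (F : Coord n → W) (θ : Coord n) : W :=
  fderiv ℝ F θ (EuclideanSpace.single i 1)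

/-- Coordinate matrix `g_{ij} = ∂X/∂θⁱ · ∂X/∂θʲ` of the metric induced by `X`. -/
def inducedMetric {n : ℕ} (X : Coord n → Amb n) (θ : Coord n) : Matrix (Fin n) (Fin n) ℝ :=
  Matrix.of fun i j => inner ℝ (pd i X θ) (pd j X θ)

/-- Christoffel symbols `Γ(g)^k_{ij}`. -/
def christoffel {n : ℕ} (g : Coord n → Matrix (Fin n) (Fin n) ℝ) (k i j : Fin n)
    (θ : Coord n) : ℝ :=
  (1 / 2) * ∑ l, (g θ)⁻¹ k l *
    (pd i (fun θ' => g θ' l j) θ + pd j (fun θ' => g θ' l i) θ - pd l (fun θ' => g θ' i j) θ)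

/-- Coordinate expression of the Laplace operator,
`g^{ij} (∂²F/∂θⁱ∂θʲ - Γ(g)^k_{ij} ∂F/∂θᵏ)`, for vector-valued `F`, componentwise. -/
def laplaceCoord {n : ℕ} {W : Type*} [NormedAddCommGroup W] [NormedSpace ℝ W]
    (g : Coord n → Matrix (Fin n) (Fin n) ℝ) (F : Coord n → W) (θ : Coord n) : W :=
  ∑ i, ∑ j, (g θ)⁻¹ i j • (pd i (pd j F) θ - ∑ k, christoffel g k i j θ • pd k F θ)

/-- Coordinate expression of the map Laplacian `Δ_{g,h}`, component `q`,
`g^{ij} (∂²Ψ^q/∂θⁱ∂θʲ - Γ(g)^k_{ij} ∂Ψ^q/∂θᵏ + (Γ(h)^q_{mn} ∘ Ψ) ∂Ψ^m/∂θⁱ ∂Ψⁿ/∂θʲ)`. -/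
def mapLaplaceCoord {n : ℕ} (g h : Coord n → Matrix (Fin n) (Fin n) ℝ)
    (Ψ : Coord n → Coord n) (q : Fin n) (θ : Coord n) : ℝ :=
  ∑ i, ∑ j, (g θ)⁻¹ i j *
    (pd i (pd j (fun θ' => Ψ θ' q)) θ
      - ∑ k, christoffel g k i j θ * pd k (fun θ' => Ψ θ' q) θ
      + ∑ a, ∑ b, christoffel h q a b (Ψ θ) *
          pd i (fun θ' => Ψ θ' a) θ * pd j (fun θ' => Ψ θ' b) θ)

/-- Mean curvature of the immersion `X` with respect to the unit normal vector `N`,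
`H = - g^{ij} ∂²X/∂θⁱ∂θʲ · N` (positive for round spheres with outward normal). -/
def meanCurvature {n : ℕ} (X : Coord n → Amb n) (N : Amb n) (θ : Coord n) : ℝ :=
  - ∑ i, ∑ j, (inducedMetric X θ)⁻¹ i j * inner ℝ (pd i (pd j X) θ) N

/-- The Laplacian `Δ_g f` at the point `p` of the smooth hypersurface `M`, where `g` is the metric
induced on `M` by the immersion `y`. The coordinate expression does not depend on
the chart, so some chart around `p` is chosen. -/
def laplacian {n : ℕ} (M : Set (Amb n)) (y f : Amb n → Amb n) (p : Amb n) : Amb n :=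
  Classical.epsilon fun L => ∃ φ : LocalParam n ∞ M, ∃ θ ∈ φ.dom, φ.map θ = p ∧
    L = laplaceCoord (inducedMetric (y ∘ φ.map)) (f ∘ φ.map) θ

/-! ### The flows

Maps on `M × [0,T)` are represented by functions `ℝ → ℝⁿ⁺¹ → ℝⁿ⁺¹` of which only the values at
`t ∈ [0,T)`, `p ∈ M` matter. At `t = 0`, time derivatives are one-sided. -/

/-- `x : M × [0,T) → ℝⁿ⁺¹` is a time-dependent embedding of class `C²`
moving by mean curvature flow, `∂x/∂t = -(H ν) ∘ x`. The vector `H ν` does not depend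
on the choice of the unit normal. -/
structure IsMeanCurvatureFlow {n : ℕ} (M : Set (Amb n)) (T : ℝ) (x : ℝ → Amb n → Amb n) :
    Prop where
  contDiffOn : ContDiffOn ℝ 2 (fun q : ℝ × Amb n => x q.1 q.2) (Ico 0 T ×ˢ M)
  immersion : ∀ t ∈ Ico 0 T, ∀ φ : LocalParam n ∞ M, ∀ θ ∈ φ.dom,
    Function.Injective (fderiv ℝ (x t ∘ φ.map) θ)
  embedding : ∀ t ∈ Ico 0 T, Topology.IsEmbedding (M.domRestrict (x t))
  evolution : ∀ t ∈ Ico 0 T, ∀ φ : LocalParam n ∞ M, ∀ θ ∈ φ.dom, ∀ N : Amb n,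
    IsUnitNormalAt (x t '' M) (x t (φ.map θ)) N →
      derivWithin (fun s => x s (φ.map θ)) (Ico 0 T) t
        = -(meanCurvature (x t ∘ φ.map) N θ • N)

/-- `ψ : M × [0,T) → M` is a family of diffeomorphisms (the family and the family of
inverses are `C²`), starting from the identity and solving the harmonic map heat flow
`∂ψ/∂t = (1/α) Δ_{g(t),h} ψ`, where `g(t)` is the metric induced by `x t`, and `h` is the metric
on `M` induced by the ambient space. -/
structure IsHarmonicMapHeatFlow {n : ℕ} (M : Set (Amb n)) (T α : ℝ)
    (x ψ : ℝ → Amb n → Amb n) : Prop where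
  bijOn : ∀ t ∈ Ico 0 T, BijOn (ψ t) M M
  contDiffOn : ContDiffOn ℝ 2 (fun q : ℝ × Amb n => ψ q.1 q.2) (Ico 0 T ×ˢ M)
  contDiffOn_inv : ContDiffOn ℝ 2 (fun q : ℝ × Amb n => Function.invFunOn (ψ q.1) M q.2)
    (Ico 0 T ×ˢ M)
  initial : ∀ p ∈ M, ψ 0 p = p
  evolution : ∀ t ∈ Ico 0 T, ∀ φ₁ φ₂ : LocalParam n ∞ M, ∀ θ ∈ φ₁.dom,
    ψ t (φ₁.map θ) ∈ φ₂.map '' φ₂.dom → ∀ q : Fin n,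
      derivWithin (fun s => φ₂.chart (ψ s (φ₁.map θ)) q) (Ico 0 T) t
        = (1 / α) * mapLaplaceCoord (inducedMetric (x t ∘ φ₁.map)) (inducedMetric φ₂.map)
            (fun θ' => φ₂.chart (ψ t (φ₁.map θ'))) q θ

/-- The reparametrized flow `x̂(t) = x(t) ∘ ψ(t)⁻¹`. -/
def deTurckFlow {n : ℕ} (M : Set (Amb n)) (x ψ : ℝ → Amb n → Amb n) (t : ℝ) :
    Amb n → Amb n :=
  fun p => x t (Function.invFunOn (ψ t) M p)

/-! ### Calculus on a hypersurface `S` with unit normal field `ν` -/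

/-- Tangential gradient `∇_S f` of a map `f`, as the matrix with entries
`D_γ f_β = ∂_γ f_β - (ν · ∇f_β) ν_γ`. Here `fderivWithin ℝ f S y` is the derivative of some
extension of `f|_S` differentiable at `y`; the projection makes the result independent of it. -/
def tangentialGradient {n : ℕ} (S : Set (Amb n)) (ν f : Amb n → Amb n) (y : Amb n) :
    Matrix (Fin (n + 1)) (Fin (n + 1)) ℝ :=
  Matrix.of fun β γ =>
    fderivWithin ℝ f S y (EuclideanSpace.single γ 1) β - fderivWithin ℝ f S y (ν y) β * ν y γ

/-- The scalar product `A : B` of matrices. -/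
def frobProd {n : ℕ} (A B : Matrix (Fin n) (Fin n) ℝ) : ℝ :=
  ∑ β, ∑ γ, A β γ * B β γ

/-- The surface measure `dσ` on `S ⊆ ℝⁿ⁺¹`, i.e. the `n`-dimensional Hausdorff measure. -/
def surfaceMeasure {n : ℕ} (S : Set (Amb n)) : Measure (Amb n) :=
  (Measure.euclideanHausdorffMeasure n : Measure (Amb n)).restrict S

/-- `η ∈ H^{1,2}(S, ℝⁿ⁺¹)` with weak tangential gradient `∇_S η = Dη`, for a compact `C²`
hypersurface `S`: both are square integrable, the rows of `Dη` are tangential, and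
`∫ η_β div_S Φ dσ = - ∫ (∇_S η_β) · Φ dσ` for all tangential `C¹` vector fields `Φ` on `S`,
where `div_S Φ` is the trace of `∇_S Φ`. -/
structure IsSobolevH12 {n : ℕ} (S : Set (Amb n)) (ν η : Amb n → Amb n)
    (Dη : Amb n → Matrix (Fin (n + 1)) (Fin (n + 1)) ℝ) : Prop where
  memLp : MemLp η 2 (surfaceMeasure S)
  memLp_grad : ∀ β γ, MemLp (fun y => Dη y β γ) 2 (surfaceMeasure S)
  tangential : ∀ᵐ y ∂(surfaceMeasure S), Dη y *ᵥ (ν y).ofLp = 0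
  weak : ∀ β, ∀ Φ : Amb n → Amb n, ContDiffOn ℝ 1 Φ S → (∀ y ∈ S, inner ℝ (Φ y) (ν y) = 0) →
    ∫ y, η y β * (tangentialGradient S ν Φ y).trace ∂(surfaceMeasure S)
      = -∫ y, ∑ γ, Dη y β γ * Φ y γ ∂(surfaceMeasure S)

/-! ### Quantities on the moving hypersurface `Γ(t) = x̂(M, t)` -/

/-- Material derivative `(∂•f)(·,t) = ∂/∂t (f ∘ x̂) ∘ x̂⁻¹` of `f` on `Γ(t)`, along
`x̂ : M × [0,T) → ℝⁿ⁺¹`. -/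
def materialDeriv {n : ℕ} (M : Set (Amb n)) (T : ℝ) (xhat f : ℝ → Amb n → Amb n) (t : ℝ)
    (y : Amb n) : Amb n :=
  derivWithin (fun s => f s (xhat s (Function.invFunOn (xhat t) M y))) (Ico 0 T) t

/-- `Ĥ = (∇_S z)ᵀ ∇_S z + ν ⊗ ν`, for a map `z` on `S`. -/
def metricRep {n : ℕ} (S : Set (Amb n)) (ν z : Amb n → Amb n) (y : Amb n) :
    Matrix (Fin (n + 1)) (Fin (n + 1)) ℝ :=
  (tangentialGradient S ν z y)ᵀ * tangentialGradient S ν z y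
    + Matrix.vecMulVec (ν y).ofLp (ν y).ofLp

end

/-! Write `S = Γ(t)`, let `z` be the inverse of `x̂ = x̂(t)`, and let `Δ_S = div_S ∇_S`. The surface
Laplacian of the identity of `S` is the mean curvature vector, so the flow says `∂x/∂t = Δ_S id`, a
normal vector (`laplaceCoord_self`). Differentiating `x = x̂ ∘ ψ` in time and inserting the harmonic
map heat flow gives `Δ_S id = ∂•u + α⁻¹ τ`, where `τ = dx̂(Δ_{g,h} ψ)` is tangent to `S`. Therefore
`(∂•u · ν) ν = Δ_S id`, and `α ∂•u + (1 - α)(∂•u · ν) ν = Δ_S id - τ`.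

It remains to express `τ` through `z`. Since `h` is induced by the ambient space, `Δ_{g,h} ψ` is the
part tangent to `M` of the componentwise Laplacian of `ψ` (`inner_laplaceCoord_comp`), and that
Laplacian is `Δ_S z`, because `z ∘ x = ψ` and `x(t)` is an isometry from `g(t)` onto `S`. Now `∇_S
z` sends `τ` to `Δ_{g,h} ψ`, and `(∇_S z)ᵀ` annihilates vectors normal to `M`. With `ν · τ = 0` this
yields `Ĥ τ = (∇_S z)ᵀ Δ_S z`. All of this is the pointwise statement `deTurckFlow_equation`.

Likewise `w = Δ_S z`, because `x̂` is an isometry from `ĝ` onto `S`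
(`laplacian_id_eq_surfaceLaplacian`). As `Ĥ` is symmetric, `τ · η = w · (∇_S z Ĥ⁻¹ η)`. Both weak
equations then follow from Green's formula, applied to `id` and to `z`; it needs only that the rows
of `∇_S f` are tangential `C¹` fields, which are admissible in the definition of the weak gradient.
-/

open Filter Topology

/-! ### Local parametrizations and their charts -/

namespace LocalParam

variable {n : ℕ} {k : WithTop ℕ∞} {S : Set (Amb n)} (X : LocalParam n k S) {θ : Coord n}

theorem contDiffAt (hθ : θ ∈ X.dom) : ContDiffAt ℝ k X.map θ :=
  X.contDiffOn.contDiffAt (X.isOpen_dom.mem_nhds hθ)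

theorem differentiableAt (hk : 1 ≤ k) (hθ : θ ∈ X.dom) : DifferentiableAt ℝ X.map θ :=
  (X.contDiffAt hθ).differentiableAt (by rintro rfl; simp at hk)

theorem map_mem (hθ : θ ∈ X.dom) : X.map θ ∈ S := by
  obtain ⟨U, -, hU⟩ := X.image_open X.dom subset_rfl X.isOpen_dom
  have h : X.map θ ∈ X.map '' X.dom := mem_image_of_mem _ hθ
  rw [hU] at h
  exact h.1

theorem mapsTo : MapsTo X.map X.dom S := fun _ h => X.map_mem h

theorem chart_map (hθ : θ ∈ X.dom) : X.chart (X.map θ) = θ :=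
  X.injOn.leftInvOn_invFunOn hθ

theorem map_chart {y : Amb n} (hy : y ∈ X.map '' X.dom) : X.map (X.chart y) = y :=
  Function.invFunOn_eq hy

theorem chart_mem {y : Amb n} (hy : y ∈ X.map '' X.dom) : X.chart y ∈ X.dom :=
  Function.invFunOn_mem hy

theorem image_mem_nhdsWithin {W : Set (Coord n)} (hW : W ∈ 𝓝 θ) (hθ : θ ∈ X.dom) :
    X.map '' W ∈ 𝓝[S] X.map θ := by
  obtain ⟨V, hVW, hV, hθV⟩ := mem_nhds_iff.1 (inter_mem hW (X.isOpen_dom.mem_nhds hθ))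
  obtain ⟨U, hU, hVU⟩ := X.image_open V (hVW.trans inter_subset_right) hV
  have h : X.map θ ∈ X.map '' V := mem_image_of_mem _ hθV
  refine mem_of_superset ?_ (image_mono (hVW.trans inter_subset_left))
  rw [hVU] at h ⊢
  exact inter_mem self_mem_nhdsWithin (mem_nhdsWithin_of_mem_nhds (hU.mem_nhds h.2))

theorem image_dom_mem_nhdsWithin (hθ : θ ∈ X.dom) : X.map '' X.dom ∈ 𝓝[S] X.map θ :=
  X.image_mem_nhdsWithin (X.isOpen_dom.mem_nhds hθ) hθ

/-- Charts of a `C^k` hypersurface are restrictions of `C^k` maps of the ambient space. -/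
theorem contDiffWithinAt_chart (hk : 1 ≤ k) (hθ : θ ∈ X.dom) :
    ContDiffWithinAt ℝ k X.chart S (X.map θ) := by
  have hk0 : k ≠ 0 := by rintro rfl; simp at hk
  -- If `L` is a linear left inverse of the derivative at `θ`, then `L ∘ map` has derivative the
  -- identity there. Its local inverse composed with `L` is a map of the ambient space that agrees
  -- with the chart on `S` near the point.
  obtain ⟨L, hL⟩ := (fderiv ℝ X.map θ : Coord n →ₗ[ℝ] Amb n).exists_leftInverse_of_injective
    (LinearMap.ker_eq_bot.2 (X.injective_fderiv θ hθ))
  have hf : ContDiffAt ℝ k (fun θ' => L.toContinuousLinearMap (X.map θ')) θ :=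
    L.toContinuousLinearMap.contDiff.contDiffAt.comp θ (X.contDiffAt hθ)
  have hf' : HasFDerivAt (fun θ' => L.toContinuousLinearMap (X.map θ'))
      ((ContinuousLinearEquiv.refl ℝ (Coord n) : Coord n ≃L[ℝ] Coord n) :
        Coord n →L[ℝ] Coord n) θ := by
    refine (L.toContinuousLinearMap.hasFDerivAt.comp θ
      (X.differentiableAt hk hθ).hasFDerivAt).congr_fderiv ?_
    ext1 v
    exact LinearMap.congr_fun hL v
  have hG := hf.to_localInverse hf' hk0
  have hleft := (hf.hasStrictFDerivAt' hf' hk0).eventually_left_inverse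
  have hπ : ContDiffAt ℝ k (hf.localInverse hf' hk0 ∘ L.toContinuousLinearMap) (X.map θ) :=
    hG.comp _ L.toContinuousLinearMap.contDiff.contDiffAt
  refine hπ.contDiffWithinAt.congr_of_eventuallyEq_of_mem ?_ (X.map_mem hθ)
  filter_upwards [X.image_mem_nhdsWithin (inter_mem hleft (X.isOpen_dom.mem_nhds hθ)) hθ]
  rintro _ ⟨θ', ⟨h1, h2⟩, rfl⟩
  rw [X.chart_map h2]
  exact h1.symm

variable {W : Type*} [NormedAddCommGroup W] [NormedSpace ℝ W]

theorem eventuallyEq_comp_chart {W : Type*} (F : Amb n → W) (hθ : θ ∈ X.dom) :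
    F =ᶠ[𝓝[S] X.map θ] (F ∘ X.map) ∘ X.chart := by
  filter_upwards [X.image_dom_mem_nhdsWithin hθ] with y hy
  simp [X.map_chart hy]

/-- Near the point, `F` on `S` is its coordinate expression composed with the chart, so regularity
can be checked in coordinates. -/
theorem contDiffWithinAt_of_comp {m : WithTop ℕ∞} {F : Amb n → W} (hk : 1 ≤ k) (hm : m ≤ k)
    (hθ : θ ∈ X.dom) (hF : ContDiffAt ℝ m (F ∘ X.map) θ) :
    ContDiffWithinAt ℝ m F S (X.map θ) := by
  refine ContDiffWithinAt.congr_of_eventuallyEq_of_mem ?_ (X.eventuallyEq_comp_chart F hθ)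
    (X.map_mem hθ)
  rw [← X.chart_map hθ] at hF
  exact hF.comp_contDiffWithinAt _ ((X.contDiffWithinAt_chart hk hθ).of_le hm)

theorem contDiffAt_comp {m : WithTop ℕ∞} {F : Amb n → W} (hm : m ≤ k) (hF : ContDiffOn ℝ m F S)
    (hθ : θ ∈ X.dom) : ContDiffAt ℝ m (F ∘ X.map) θ :=
  (hF.comp (X.contDiffOn.of_le hm) X.mapsTo).contDiffAt (X.isOpen_dom.mem_nhds hθ)

/-- `fderivWithin` along a hypersurface is not unique in the normal direction. On tangent vectors
the chain rule pins it down. -/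
theorem fderivWithin_apply_fderiv {F : Amb n → W} (hk : 1 ≤ k) (hθ : θ ∈ X.dom)
    (hF : DifferentiableWithinAt ℝ F S (X.map θ)) (v : Coord n) :
    fderivWithin ℝ F S (X.map θ) (fderiv ℝ X.map θ v) = fderiv ℝ (F ∘ X.map) θ v := by
  have h := hF.hasFDerivWithinAt.comp θ
    (X.differentiableAt hk hθ).hasFDerivAt.hasFDerivWithinAt X.mapsTo
  rw [(h.hasFDerivAt (X.isOpen_dom.mem_nhds hθ)).fderiv]
  rfl

theorem fderivWithin_apply_pd {F : Amb n → W} (hk : 1 ≤ k) (hθ : θ ∈ X.dom)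
    (hF : DifferentiableWithinAt ℝ F S (X.map θ)) (i : Fin n) :
    fderivWithin ℝ F S (X.map θ) (pd i X.map θ) = pd i (F ∘ X.map) θ :=
  X.fderivWithin_apply_fderiv hk hθ hF _

end LocalParam

/-! ### Tangent vectors and normals -/

theorem fderiv_eq_sum_pd {n : ℕ} {W : Type*} [NormedAddCommGroup W] [NormedSpace ℝ W]
    (F : Coord n → W) (θ v : Coord n) : fderiv ℝ F θ v = ∑ i, v i • pd i F θ := by
  conv_lhs => rw [← (EuclideanSpace.basisFun (Fin n) ℝ).sum_repr v]
  simp [pd]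

theorem linearIndependent_pd {n : ℕ} {W : Type*} [NormedAddCommGroup W] [NormedSpace ℝ W]
    {F : Coord n → W} {θ : Coord n} (h : Function.Injective (fderiv ℝ F θ)) :
    LinearIndependent ℝ (fun i => pd i F θ) := by
  have := (EuclideanSpace.basisFun (Fin n) ℝ).toBasis.linearIndependent.map'
    (fderiv ℝ F θ : Coord n →ₗ[ℝ] W) (LinearMap.ker_eq_bot.2 h)
  have h' : (fun i => pd i F θ) = (fderiv ℝ F θ : Coord n →ₗ[ℝ] W) ∘
      (EuclideanSpace.basisFun (Fin n) ℝ).toBasis := by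
    ext i
    simp [pd]
  rw [h']
  exact this

theorem isUnit_det_inducedMetric {n : ℕ} {Y : Coord n → Amb n} {θ : Coord n}
    (h : Function.Injective (fderiv ℝ Y θ)) : IsUnit (inducedMetric Y θ).det :=
  (Matrix.posDef_gram_of_linearIndependent (linearIndependent_pd h)).det_pos.ne'.isUnit

theorem inducedMetric_comm {n : ℕ} (Y : Coord n → Amb n) (θ : Coord n) (i j : Fin n) :
    inducedMetric Y θ i j = inducedMetric Y θ j i := by
  simp only [inducedMetric, Matrix.of_apply]
  exact real_inner_comm _ _

theorem inv_inducedMetric_comm {n : ℕ} (Y : Coord n → Amb n) (θ : Coord n) (i j : Fin n) :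
    (inducedMetric Y θ)⁻¹ i j = (inducedMetric Y θ)⁻¹ j i := by
  have h : (inducedMetric Y θ)ᵀ = inducedMetric Y θ := by
    ext i j
    exact inducedMetric_comm Y θ j i
  conv_lhs => rw [← h, ← Matrix.transpose_nonsing_inv]
  rfl

theorem sum_inv_inducedMetric_mul {n : ℕ} {Y : Coord n → Amb n} {θ : Coord n}
    (h : Function.Injective (fderiv ℝ Y θ)) (i l : Fin n) :
    ∑ j, (inducedMetric Y θ)⁻¹ i j * inner ℝ (pd j Y θ) (pd l Y θ) = if i = l then 1 else 0 := by
  have := congr_fun₂ (Matrix.nonsing_inv_mul _ (isUnit_det_inducedMetric h)) i l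
  rwa [Matrix.mul_apply, Matrix.one_apply] at this

/-- A vector orthogonal to the coordinate vectors is a multiple of the unit normal. -/
theorem eq_smul_of_inner_pd_eq_zero {n : ℕ} {Y : Coord n → Amb n} {θ : Coord n}
    (h : Function.Injective (fderiv ℝ Y θ)) {N r : Amb n} (hN : ‖N‖ = 1)
    (hNY : ∀ i, inner ℝ N (pd i Y θ) = 0) (hr : ∀ i, inner ℝ r (pd i Y θ) = 0) :
    r = inner ℝ r N • N := by
  set K := Submodule.span ℝ (Set.range fun i => pd i Y θ)
  -- Codimension one: the normal space is a line, spanned by `N`.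
  have hK : Module.finrank ℝ Kᗮ = 1 := by
    have h1 := K.finrank_add_finrank_orthogonal
    rw [finrank_span_eq_card (linearIndependent_pd h)] at h1
    simp at h1
    omega
  have mem : ∀ v : Amb n, (∀ i, inner ℝ v (pd i Y θ) = 0) → v ∈ Kᗮ := by
    intro v hv
    rw [Submodule.mem_orthogonal']
    intro w hw
    induction hw using Submodule.span_induction with
    | mem x hx => obtain ⟨i, rfl⟩ := hx; exact hv i
    | zero => simp
    | add x y _ _ hx hy => rw [inner_add_right, hx, hy, add_zero]
    | smul a x _ hx => rw [inner_smul_right, hx, mul_zero]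
  obtain ⟨c, hc⟩ := (finrank_eq_one_iff_of_nonzero' (⟨N, mem N hNY⟩ : Kᗮ) (by
    intro h0
    have : N = 0 := congrArg Subtype.val h0
    simp [this] at hN)).1 hK ⟨r, mem r hr⟩
  have hc' : c • N = r := congrArg Subtype.val hc
  rw [← hc', inner_smul_left, real_inner_self_eq_norm_sq, hN]
  simp

/-- Decomposition of a vector into its tangential part, in local coordinates, and its normal
part. -/
theorem eq_sum_pd_add_normal {n : ℕ} {Y : Coord n → Amb n} {θ : Coord n}
    (h : Function.Injective (fderiv ℝ Y θ)) {N : Amb n} (hN : ‖N‖ = 1)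
    (hNY : ∀ i, inner ℝ N (pd i Y θ) = 0) (v : Amb n) :
    v = ∑ i, ∑ j, ((inducedMetric Y θ)⁻¹ i j * inner ℝ v (pd i Y θ)) • pd j Y θ
      + inner ℝ v N • N := by
  set s := ∑ i, ∑ j, ((inducedMetric Y θ)⁻¹ i j * inner ℝ v (pd i Y θ)) • pd j Y θ with hs
  -- `s` has the same products with the coordinate vectors as `v`, so `v - s` is normal.
  have h1 : ∀ l, inner ℝ s (pd l Y θ) = inner ℝ v (pd l Y θ) := by
    intro l
    simp only [hs, sum_inner, inner_smul_left, RCLike.conj_to_real]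
    have : ∀ i, ∑ j, (inducedMetric Y θ)⁻¹ i j * inner ℝ v (pd i Y θ)
        * inner ℝ (pd j Y θ) (pd l Y θ) = (if i = l then 1 else 0) * inner ℝ v (pd i Y θ) := by
      intro i
      rw [← sum_inv_inducedMetric_mul h i l, Finset.sum_mul]
      exact Finset.sum_congr rfl fun j _ => by ring
    simp [this]
  have h2 : inner ℝ s N = 0 := by
    simp only [hs, sum_inner, inner_smul_left]
    simp [real_inner_comm N, hNY]
  have h3 := eq_smul_of_inner_pd_eq_zero h hN hNY (r := v - s) fun l => by
    rw [inner_sub_left, h1, sub_self]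
  rw [inner_sub_left, h2, sub_zero] at h3
  rw [← h3]
  abel

/-- This turns the tangent cone in `IsUnitNormalAt` into orthogonality to the coordinate vectors. -/
theorem LocalParam.fderiv_mem_tangentConeAt {n : ℕ} {k : WithTop ℕ∞} {S : Set (Amb n)}
    (X : LocalParam n k S) (hk : 1 ≤ k) {θ : Coord n} (hθ : θ ∈ X.dom) (v : Coord n) :
    fderiv ℝ X.map θ v ∈ tangentConeAt ℝ S (X.map θ) := by
  have h := (X.differentiableAt hk hθ).hasFDerivAt.hasFDerivWithinAt (s := X.dom)
  refine tangentConeAt_mono (image_subset_iff.2 X.mapsTo) (h.mapsTo_tangent_cone ?_)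
  rw [tangentConeAt_of_mem_nhds (X.isOpen_dom.mem_nhds hθ)]
  trivial

theorem IsUnitNormalAt.inner_pd {n : ℕ} {k : WithTop ℕ∞} {S : Set (Amb n)}
    {X : LocalParam n k S} {θ : Coord n} {N : Amb n} (hN : IsUnitNormalAt S (X.map θ) N)
    (hk : 1 ≤ k) (hθ : θ ∈ X.dom) (i : Fin n) : inner ℝ N (pd i X.map θ) = 0 :=
  hN.2 _ (X.fderiv_mem_tangentConeAt hk hθ _)

/-! ### Partial derivatives and Christoffel symbols -/

section PartialDerivatives

variable {n : ℕ} {W : Type*} [NormedAddCommGroup W] [NormedSpace ℝ W] {θ : Coord n}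

theorem ContDiffAt.pd {m k : WithTop ℕ∞} {F : Coord n → W} (hF : ContDiffAt ℝ k F θ)
    (hm : m + 1 ≤ k) (i : Fin n) : ContDiffAt ℝ m (pd i F) θ :=
  (hF.fderiv_right hm).clm_apply contDiffAt_const

theorem ContDiffAt.differentiableAt_pd {F : Coord n → W} (hF : ContDiffAt ℝ 2 F θ) (i : Fin n) :
    DifferentiableAt ℝ (_root_.pd i F) θ :=
  (hF.pd (m := 1) (by norm_num) i).differentiableAt (by norm_num)

theorem pd_pd_eq {F : Coord n → W} (hF : ContDiffAt ℝ 2 F θ) (i j : Fin n) :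
    pd i (pd j F) θ = fderiv ℝ (fderiv ℝ F) θ (EuclideanSpace.single i 1)
      (EuclideanSpace.single j 1) := by
  have h : DifferentiableAt ℝ (fderiv ℝ F) θ :=
    (hF.fderiv_right (m := 1) (by norm_num)).differentiableAt (by norm_num)
  have h' : pd j F = fun θ' => fderiv ℝ F θ' (EuclideanSpace.single j 1) := rfl
  rw [h', pd, fderiv_clm_apply h (differentiableAt_const _)]
  simp

theorem pd_comm {F : Coord n → W} (hF : ContDiffAt ℝ 2 F θ) (i j : Fin n) :
    pd i (pd j F) θ = pd j (pd i F) θ := by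
  rw [pd_pd_eq hF, pd_pd_eq hF]
  exact hF.isSymmSndFDerivAt (by simp) _ _

theorem pd_congr {F G : Coord n → W} (h : F =ᶠ[𝓝 θ] G) (i : Fin n) : pd i F θ = pd i G θ := by
  simp only [pd, h.fderiv_eq]

theorem pd_inner {F G : Coord n → Amb n} (hF : DifferentiableAt ℝ F θ)
    (hG : DifferentiableAt ℝ G θ) (i : Fin n) :
    pd i (fun θ' => inner ℝ (F θ') (G θ')) θ
      = inner ℝ (F θ) (pd i G θ) + inner ℝ (pd i F θ) (G θ) := by
  simp only [pd]
  rw [fderiv_inner_apply ℝ hF hG]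

theorem pd_apply {ι : Type*} [Fintype ι] {F : Coord n → EuclideanSpace ℝ ι}
    (hF : DifferentiableAt ℝ F θ) (i : Fin n) (β : ι) :
    pd i (fun θ' => F θ' β) θ = pd i F θ β := by
  simp only [pd]
  have := ((EuclideanSpace.proj β : EuclideanSpace ℝ ι →L[ℝ] ℝ).hasFDerivAt.comp θ
    hF.hasFDerivAt).fderiv
  exact congrArg (fun L => L (EuclideanSpace.single i 1)) this

/-- The product rule expands the three metric derivatives into six terms. By symmetry of second
derivatives four of them cancel and the other two agree, absorbing the factor `1/2`. -/
theorem christoffel_inducedMetric {Y : Coord n → Amb n} (hY : ContDiffAt ℝ 2 Y θ)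
    (k i j : Fin n) : christoffel (inducedMetric Y) k i j θ
      = ∑ l, (inducedMetric Y θ)⁻¹ k l * inner ℝ (pd i (pd j Y) θ) (pd l Y θ) := by
  have h : ∀ a b c, pd a (fun θ' => inducedMetric Y θ' b c) θ
      = inner ℝ (pd b Y θ) (pd a (pd c Y) θ) + inner ℝ (pd a (pd b Y) θ) (pd c Y θ) :=
    fun a b c => pd_inner (hY.differentiableAt_pd b) (hY.differentiableAt_pd c) a
  simp only [christoffel, Finset.mul_sum]
  refine Finset.sum_congr rfl fun l _ => ?_
  rw [h, h, h, pd_comm hY l i, pd_comm hY l j, pd_comm hY j i,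
    real_inner_comm (pd l Y θ) (pd i (pd j Y) θ), real_inner_comm (pd j Y θ) (pd i (pd l Y) θ),
    real_inner_comm (pd i Y θ) (pd j (pd l Y) θ)]
  ring

theorem contDiffAt_inducedMetric {m k : WithTop ℕ∞} {Y : Coord n → Amb n}
    (hY : ContDiffAt ℝ k Y θ) (hm : m + 1 ≤ k) (i j : Fin n) :
    ContDiffAt ℝ m (fun θ' => inducedMetric Y θ' i j) θ :=
  (hY.pd hm i).inner ℝ (hY.pd hm j)

end PartialDerivatives

/-! ### Regularity of determinants and inverses of matrix-valued functions -/

theorem ContDiffAt.matrix_det {n : ℕ} {E : Type*} [NormedAddCommGroup E] [NormedSpace ℝ E]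
    {m : WithTop ℕ∞} {p : E} {A : E → Matrix (Fin n) (Fin n) ℝ}
    (hA : ∀ i j, ContDiffAt ℝ m (fun q => A q i j) p) : ContDiffAt ℝ m (fun q => (A q).det) p := by
  simp only [Matrix.det_apply']
  refine ContDiffAt.sum fun σ _ => contDiffAt_const.mul ?_
  exact contDiffAt_prod fun i _ => hA _ _

theorem ContDiffAt.matrix_inv {n : ℕ} {E : Type*} [NormedAddCommGroup E] [NormedSpace ℝ E]
    {m : WithTop ℕ∞} {p : E} {A : E → Matrix (Fin n) (Fin n) ℝ}
    (hA : ∀ i j, ContDiffAt ℝ m (fun q => A q i j) p) (hp : IsUnit (A p).det) (i j : Fin n) :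
    ContDiffAt ℝ m (fun q => (A q)⁻¹ i j) p := by
  simp only [Matrix.inv_def, Matrix.smul_apply, Ring.inverse_eq_inv', Matrix.adjugate_apply,
    smul_eq_mul]
  refine ((ContDiffAt.matrix_det hA).inv hp.ne_zero).mul (ContDiffAt.matrix_det fun a b => ?_)
  by_cases h : a = j
  · subst h
    simp only [Matrix.updateRow_self]
    exact contDiffAt_const
  · simp only [Matrix.updateRow_ne h]
    exact hA a b

theorem ContinuousWithinAt.matrix_inv {n : ℕ} {E : Type*} [TopologicalSpace E] {s : Set E}
    {p : E} {A : E → Matrix (Fin n) (Fin n) ℝ} (hA : ContinuousWithinAt A s p)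
    (hp : IsUnit (A p).det) : ContinuousWithinAt (fun q => (A q)⁻¹) s p := by
  have h : ∀ B : Matrix (Fin n) (Fin n) ℝ, IsUnit B.det →
      ContinuousAt (fun C : Matrix (Fin n) (Fin n) ℝ => C⁻¹) B := by
    intro B hB
    simp only [Matrix.inv_def, Ring.inverse_eq_inv']
    have h1 : ContinuousAt (fun C : Matrix (Fin n) (Fin n) ℝ => C.det) B :=
      (Continuous.matrix_det continuous_id).continuousAt
    exact (h1.inv₀ hB.ne_zero).smul (Continuous.matrix_adjugate continuous_id).continuousAt
  exact (h _ hp).comp_continuousWithinAt hA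

/-! ### The tangential gradient in local coordinates -/

/-- The tangential gradient `∇_S f_β` of a component of `f`, as a vector field. -/
noncomputable def tangentialGradientRow {n : ℕ} (S : Set (Amb n)) (ν f : Amb n → Amb n) (β : Fin (n + 1))
    (y : Amb n) : Amb n :=
  WithLp.toLp 2 (tangentialGradient S ν f y β)

/-- The Laplace-Beltrami operator `div_S ∇_S f`, applied componentwise. -/
noncomputable def surfaceLaplacian {n : ℕ} (S : Set (Amb n)) (ν f : Amb n → Amb n) (y : Amb n) : Amb n :=
  WithLp.toLp 2 fun β => (tangentialGradient S ν (tangentialGradientRow S ν f β) y).trace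

section TangentialGradient

variable {n : ℕ} {S : Set (Amb n)} {ν f : Amb n → Amb n} {y : Amb n}

theorem tangentialGradient_mulVec (v : Amb n) :
    tangentialGradient S ν f y *ᵥ v.ofLp
      = (fderivWithin ℝ f S y v - inner ℝ (ν y) v • fderivWithin ℝ f S y (ν y)).ofLp := by
  ext β
  have h : fderivWithin ℝ f S y v
      = ∑ γ, v γ • fderivWithin ℝ f S y (EuclideanSpace.single γ 1) := by
    conv_lhs => rw [← (EuclideanSpace.basisFun (Fin (n + 1)) ℝ).sum_repr v]
    simp
  rw [h]
  simp only [Matrix.mulVec, dotProduct, tangentialGradient, Matrix.of_apply, PiLp.sub_apply,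
    PiLp.smul_apply, WithLp.ofLp_sum, Finset.sum_apply, WithLp.ofLp_smul,
    Pi.smul_apply, smul_eq_mul, PiLp.inner_apply, RCLike.inner_apply,
    Finset.sum_mul]
  rw [← Finset.sum_sub_distrib]
  refine Finset.sum_congr rfl fun γ _ => ?_
  simp
  ring

theorem inner_tangentialGradientRow (β : Fin (n + 1)) (v : Amb n) :
    inner ℝ (tangentialGradientRow S ν f β y) v
      = (fderivWithin ℝ f S y v - inner ℝ (ν y) v • fderivWithin ℝ f S y (ν y)) β := by
  rw [← tangentialGradient_mulVec]
  simp [tangentialGradientRow, Matrix.mulVec, dotProduct, PiLp.inner_apply, mul_comm]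

theorem inner_tangentialGradientRow_normal (hν : ‖ν y‖ = 1) (β : Fin (n + 1)) :
    inner ℝ (tangentialGradientRow S ν f β y) (ν y) = 0 := by
  rw [inner_tangentialGradientRow, real_inner_self_eq_norm_sq, hν]
  simp

end TangentialGradient

namespace LocalParam

variable {n : ℕ} {k : WithTop ℕ∞} {S : Set (Amb n)} (X : LocalParam n k S) {θ : Coord n}
  {ν f : Amb n → Amb n}

/-- Decompose the basis vector `e_γ` into its tangential and normal parts. The normal part
contributes exactly the term that the definition subtracts, so no arbitrary normal derivative
survives. -/
theorem tangentialGradient_map (hk : 1 ≤ k) (hθ : θ ∈ X.dom)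
    (hν : IsUnitNormalAt S (X.map θ) (ν (X.map θ)))
    (hf : DifferentiableWithinAt ℝ f S (X.map θ)) (β γ : Fin (n + 1)) :
    tangentialGradient S ν f (X.map θ) β γ
      = ∑ i, ∑ j, (inducedMetric X.map θ)⁻¹ i j * pd i X.map θ γ * pd j (f ∘ X.map) θ β := by
  have h := eq_sum_pd_add_normal (X.injective_fderiv θ hθ) hν.1 (hν.inner_pd hk hθ)
    (EuclideanSpace.single γ 1)
  simp only [EuclideanSpace.inner_single_left, map_one, one_mul] at h
  simp only [tangentialGradient, Matrix.of_apply]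
  conv_lhs => rw [h]
  simp only [map_add, map_sum, map_smul, X.fderivWithin_apply_pd hk hθ hf]
  simp [mul_comm (ν (X.map θ) γ)]

theorem tangentialGradientRow_map (hk : 1 ≤ k) (hθ : θ ∈ X.dom)
    (hν : IsUnitNormalAt S (X.map θ) (ν (X.map θ)))
    (hf : DifferentiableWithinAt ℝ f S (X.map θ)) (β : Fin (n + 1)) :
    tangentialGradientRow S ν f β (X.map θ)
      = ∑ i, ∑ j, ((inducedMetric X.map θ)⁻¹ i j * pd j (f ∘ X.map) θ β) • pd i X.map θ := by
  ext γ
  simp only [tangentialGradientRow]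
  rw [X.tangentialGradient_map hk hθ hν hf]
  simp [mul_right_comm]

theorem trace_tangentialGradient_map (hk : 1 ≤ k) (hθ : θ ∈ X.dom)
    (hν : IsUnitNormalAt S (X.map θ) (ν (X.map θ)))
    (hf : DifferentiableWithinAt ℝ f S (X.map θ)) :
    (tangentialGradient S ν f (X.map θ)).trace = ∑ i, ∑ j, (inducedMetric X.map θ)⁻¹ i j *
      inner ℝ (pd i X.map θ) (pd j (f ∘ X.map) θ) := by
  simp only [Matrix.trace, Matrix.diag, X.tangentialGradient_map hk hθ hν hf, PiLp.inner_apply,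
    Finset.mul_sum]
  rw [Finset.sum_comm]
  refine Finset.sum_congr rfl fun i _ => ?_
  rw [Finset.sum_comm]
  refine Finset.sum_congr rfl fun j _ => Finset.sum_congr rfl fun β _ => ?_
  simp
  ring

theorem contDiffAt_inv_inducedMetric {m : WithTop ℕ∞} (hm : m + 1 ≤ k) (hθ : θ ∈ X.dom)
    (i j : Fin n) : ContDiffAt ℝ m (fun θ' => (inducedMetric X.map θ')⁻¹ i j) θ :=
  ContDiffAt.matrix_inv (contDiffAt_inducedMetric (X.contDiffAt hθ) hm)
    (isUnit_det_inducedMetric (X.injective_fderiv θ hθ)) i j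

theorem contDiffAt_tangentialGradientRow_comp {m : WithTop ℕ∞} (hm : m + 1 ≤ k)
    (hν : ∀ y ∈ S, IsUnitNormalAt S y (ν y)) (hf : ContDiffOn ℝ (m + 1) f S) (hθ : θ ∈ X.dom)
    (β : Fin (n + 1)) : ContDiffAt ℝ m (tangentialGradientRow S ν f β ∘ X.map) θ := by
  have h1 : (1 : WithTop ℕ∞) ≤ m + 1 := le_add_self
  have h : tangentialGradientRow S ν f β ∘ X.map =ᶠ[𝓝 θ] fun θ =>
      ∑ i, ∑ j, ((inducedMetric X.map θ)⁻¹ i j * pd j (f ∘ X.map) θ β) • pd i X.map θ := by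
    filter_upwards [X.isOpen_dom.mem_nhds hθ] with θ' hθ'
    exact X.tangentialGradientRow_map (h1.trans hm) hθ' (hν _ (X.map_mem hθ'))
      (hf.differentiableOn (by rintro h; simp [h] at h1) _ (X.map_mem hθ')) β
  refine ContDiffAt.congr_of_eventuallyEq ?_ h
  refine ContDiffAt.sum fun i _ => ContDiffAt.sum fun j _ => ?_
  have h3 : ContDiffAt ℝ m (fun θ => pd j (f ∘ X.map) θ β) θ :=
    (contDiffAt_piLp_apply (p := 2)).comp θ ((X.contDiffAt_comp hm hf hθ).pd le_rfl j)
  exact ((X.contDiffAt_inv_inducedMetric hm hθ i j).mul h3).smul ((X.contDiffAt hθ).pd hm i)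

/-- In local coordinates, `div_S ∇_S f` is the coordinate expression of the Laplacian. -/
theorem surfaceLaplacian_map (hk : 2 ≤ k) (hν : ∀ y ∈ S, IsUnitNormalAt S y (ν y))
    (hf : ContDiffOn ℝ 2 f S) (hθ : θ ∈ X.dom) :
    surfaceLaplacian S ν f (X.map θ)
      = laplaceCoord (inducedMetric X.map) (f ∘ X.map) θ := by
  have hk1 : (1 : WithTop ℕ∞) ≤ k := le_trans (by norm_num) hk
  have h11 : (1 : WithTop ℕ∞) + 1 = 2 := by norm_num
  have hX : ContDiffAt ℝ 2 X.map θ := (X.contDiffAt hθ).of_le hk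
  have hfX : ContDiffAt ℝ 2 (f ∘ X.map) θ := X.contDiffAt_comp hk hf hθ
  have hfd := hf.differentiableOn (by norm_num)
  ext β
  have hΦ : ContDiffAt ℝ 1 (tangentialGradientRow S ν f β ∘ X.map) θ :=
    X.contDiffAt_tangentialGradientRow_comp (h11 ▸ hk) hν (h11 ▸ hf) hθ β
  have hΦd := (X.contDiffWithinAt_of_comp hk1 hk1 hθ hΦ).differentiableWithinAt (by norm_num)
  -- Differentiate `∇_S f_β · ∂_i X = ∂_i f_β` in direction `j`. The term with `∂_j ∂_i X` is the
  -- Christoffel term, because `∇_S f_β` is tangential.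
  have key : ∀ i j, inner ℝ (pd i X.map θ) (pd j (tangentialGradientRow S ν f β ∘ X.map) θ)
      = pd j (pd i (f ∘ X.map)) θ β
        - ∑ k, christoffel (inducedMetric X.map) k j i θ * pd k (f ∘ X.map) θ β := by
    intro i j
    have e : (fun θ' => inner ℝ ((tangentialGradientRow S ν f β ∘ X.map) θ') (pd i X.map θ'))
        =ᶠ[𝓝 θ] fun θ' => pd i (f ∘ X.map) θ' β := by
      filter_upwards [X.isOpen_dom.mem_nhds hθ] with θ' hθ'
      have hm := X.map_mem hθ'
      simp only [Function.comp_apply]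
      rw [inner_tangentialGradientRow, (hν _ hm).inner_pd hk1 hθ', zero_smul, sub_zero,
        X.fderivWithin_apply_pd hk1 hθ' (hfd _ hm)]
    have e' := pd_congr e j
    rw [pd_inner (hΦ.differentiableAt (by norm_num)) (hX.differentiableAt_pd i),
      pd_apply (hfX.differentiableAt_pd i)] at e'
    have hs : inner ℝ ((tangentialGradientRow S ν f β ∘ X.map) θ) (pd j (pd i X.map) θ)
        = ∑ k, christoffel (inducedMetric X.map) k j i θ * pd k (f ∘ X.map) θ β := by
      simp only [Function.comp_apply]
      rw [X.tangentialGradientRow_map hk1 hθ (hν _ (X.map_mem hθ)) (hfd _ (X.map_mem hθ)),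
        Finset.sum_comm]
      simp only [sum_inner, inner_smul_left, RCLike.conj_to_real]
      refine Finset.sum_congr rfl fun k _ => ?_
      rw [christoffel_inducedMetric hX, Finset.sum_mul]
      refine Finset.sum_congr rfl fun l _ => ?_
      rw [inv_inducedMetric_comm, real_inner_comm (pd l X.map θ)]
      simp only [Function.comp_def]
      ring
    exact (real_inner_comm _ _).trans
      (eq_sub_of_add_eq' ((congrArg (· + _) hs.symm).trans e'))
  simp only [surfaceLaplacian]
  rw [X.trace_tangentialGradient_map hk1 hθ (hν _ (X.map_mem hθ)) hΦd, Finset.sum_comm]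
  simp only [laplaceCoord, key]
  simp only [WithLp.ofLp_sum, Finset.sum_apply, WithLp.ofLp_sub, WithLp.ofLp_smul,
    Pi.sub_apply, Pi.smul_apply, smul_eq_mul]
  refine Finset.sum_congr rfl fun i _ => Finset.sum_congr rfl fun j _ => ?_
  rw [inv_inducedMetric_comm]

end LocalParam

/-! ### Regularity on a hypersurface -/

namespace IsHypersurface

variable {n : ℕ} {k : WithTop ℕ∞} {S : Set (Amb n)} {ν f : Amb n → Amb n}

theorem contDiffOn_tangentialGradientRow {m : WithTop ℕ∞} (hS : IsHypersurface n k S)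
    (hm : m + 1 ≤ k) (hν : ∀ y ∈ S, IsUnitNormalAt S y (ν y)) (hf : ContDiffOn ℝ (m + 1) f S)
    (β : Fin (n + 1)) : ContDiffOn ℝ m (tangentialGradientRow S ν f β) S := by
  intro y hy
  obtain ⟨X, θ, hθ, rfl⟩ := hS y hy
  exact X.contDiffWithinAt_of_comp (le_add_self.trans hm) (le_self_add.trans hm) hθ
    (X.contDiffAt_tangentialGradientRow_comp hm hν hf hθ β)

theorem continuousOn_tangentialGradient (hS : IsHypersurface n k S) (hk : 1 ≤ k)
    (hν : ∀ y ∈ S, IsUnitNormalAt S y (ν y)) (hf : ContDiffOn ℝ 1 f S) :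
    ContinuousOn (tangentialGradient S ν f) S := by
  refine continuousOn_pi.2 fun β => ?_
  have h := (hS.contDiffOn_tangentialGradientRow (m := 0) (by simpa using hk) hν
    (by simpa using hf) β).continuousOn
  exact (PiLp.continuous_ofLp 2 _).comp_continuousOn h

theorem continuousOn_surfaceLaplacian (hS : IsHypersurface n k S) (hk : 2 ≤ k)
    (hν : ∀ y ∈ S, IsUnitNormalAt S y (ν y)) (hf : ContDiffOn ℝ 2 f S) :
    ContinuousOn (surfaceLaplacian S ν f) S := by
  have h11 : (1 : WithTop ℕ∞) + 1 = 2 := by norm_num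
  refine (PiLp.continuous_toLp 2 _).comp_continuousOn (continuousOn_pi.2 fun β => ?_)
  have h := hS.continuousOn_tangentialGradient (le_trans (by norm_num) hk) hν
    (hS.contDiffOn_tangentialGradientRow (m := 1) (h11 ▸ hk) hν (h11 ▸ hf) β)
  exact (continuous_id.matrix_trace).comp_continuousOn h

/-- The tangential gradient of the identity is the projection onto the tangent space. -/
theorem tangentialGradient_of_eqOn_id (hS : IsHypersurface n k S) (hk : 1 ≤ k)
    (hν : ∀ y ∈ S, IsUnitNormalAt S y (ν y)) {y : Amb n} (hy : y ∈ S) :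
    tangentialGradient S ν (fun y => y) y = 1 - Matrix.vecMulVec (ν y).ofLp (ν y).ofLp := by
  obtain ⟨X, θ, hθ, rfl⟩ := hS y hy
  ext β γ
  have h := congrArg (fun v : Amb n => v β) (eq_sum_pd_add_normal (X.injective_fderiv θ hθ)
    (hν _ hy).1 ((hν _ hy).inner_pd hk hθ) (EuclideanSpace.single γ 1))
  simp only [EuclideanSpace.inner_single_left, map_one, one_mul, WithLp.ofLp_sum,
    WithLp.ofLp_add, WithLp.ofLp_smul, Pi.add_apply, Finset.sum_apply, Pi.smul_apply,
    smul_eq_mul] at h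
  refine (X.tangentialGradient_map hk hθ (hν _ hy) (f := fun y => y)
    differentiableWithinAt_id β γ).trans ?_
  simp only [Matrix.sub_apply, Matrix.vecMulVec_apply, Matrix.one_apply]
  rw [eq_sub_iff_add_eq, mul_comm (ν _ β)]
  refine h.symm.trans ?_
  simp

/-- The field `ν` itself is not assumed continuous. The product `ν ⊗ ν` does not see its sign and
equals `1 - ∇_S id`, which is continuous. -/
theorem continuousOn_vecMulVec_normal (hS : IsHypersurface n k S) (hk : 1 ≤ k)
    (hν : ∀ y ∈ S, IsUnitNormalAt S y (ν y)) :
    ContinuousOn (fun y => Matrix.vecMulVec (ν y).ofLp (ν y).ofLp) S := by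
  have h := hS.continuousOn_tangentialGradient hk hν (f := fun y => y) contDiffOn_id
  refine (continuousOn_const (c := (1 : Matrix (Fin (n + 1)) (Fin (n + 1)) ℝ)).sub h).congr ?_
  intro y hy
  simp [hS.tangentialGradient_of_eqOn_id hk hν hy]

theorem continuousOn_metricRep (hS : IsHypersurface n k S) (hk : 1 ≤ k)
    (hν : ∀ y ∈ S, IsUnitNormalAt S y (ν y)) (hf : ContDiffOn ℝ 1 f S) :
    ContinuousOn (metricRep S ν f) S := by
  have h := hS.continuousOn_tangentialGradient hk hν hf
  have hT : ContinuousOn (fun y => (tangentialGradient S ν f y)ᵀ) S :=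
    (continuous_id.matrix_transpose).comp_continuousOn h
  exact (hT.mul h).add (hS.continuousOn_vecMulVec_normal hk hν)

end IsHypersurface

theorem metricRep_isSymm {n : ℕ} (S : Set (Amb n)) (ν f : Amb n → Amb n) (y : Amb n) :
    (metricRep S ν f y)ᵀ = metricRep S ν f y := by
  simp only [metricRep, Matrix.transpose_add, Matrix.transpose_mul, Matrix.transpose_transpose]
  congr 1
  ext i j
  simp [Matrix.vecMulVec_apply, mul_comm]

/-- `Ĥ` is invertible where `z` is an immersion. -/
theorem LocalParam.isUnit_det_metricRep {n : ℕ} {k : WithTop ℕ∞} {S : Set (Amb n)}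
    (X : LocalParam n k S) (hk : 1 ≤ k) {θ : Coord n} (hθ : θ ∈ X.dom) {ν z : Amb n → Amb n}
    (hν : IsUnitNormalAt S (X.map θ) (ν (X.map θ)))
    (hz : DifferentiableWithinAt ℝ z S (X.map θ))
    (hinj : Function.Injective (fderiv ℝ (z ∘ X.map) θ)) :
    IsUnit (metricRep S ν z (X.map θ)).det := by
  rw [isUnit_iff_ne_zero]
  intro h0
  obtain ⟨v, hv0, hv⟩ := Matrix.exists_mulVec_eq_zero_iff.2 h0
  set A := tangentialGradient S ν z (X.map θ) with hA
  set N := ν (X.map θ) with hN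
  -- The quadratic form of `Ĥ` is `|A v|² + (ν · v)²`. A null vector is therefore tangential and
  -- killed by `A`, which contradicts the immersion property.
  have h1 : (A *ᵥ v) ⬝ᵥ (A *ᵥ v) + (N.ofLp ⬝ᵥ v) * (N.ofLp ⬝ᵥ v) = 0 := by
    have := congrArg (fun u => v ⬝ᵥ u) hv
    simp only [metricRep, Matrix.add_mulVec, dotProduct_add, dotProduct_zero,
      ← Matrix.mulVec_mulVec, ← hA, ← hN] at this
    rw [Matrix.dotProduct_mulVec, Matrix.vecMul_transpose, Matrix.vecMulVec_mulVec,
      dotProduct_smul] at this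
    rw [← this, dotProduct_comm v N.ofLp]
    simp
  have h2 : 0 ≤ (A *ᵥ v) ⬝ᵥ (A *ᵥ v) := Finset.sum_nonneg fun i _ => mul_self_nonneg _
  have h3 : A *ᵥ v = 0 := dotProduct_self_eq_zero.1
    (le_antisymm (by nlinarith [mul_self_nonneg (N.ofLp ⬝ᵥ v)]) h2)
  have h4 : N.ofLp ⬝ᵥ v = 0 := mul_self_eq_zero.1
    (le_antisymm (by linarith) (mul_self_nonneg _))
  set V : Amb n := WithLp.toLp 2 v with hV
  have h5 : inner ℝ V N = 0 := by
    rw [← h4]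
    simp [PiLp.inner_apply, dotProduct, hV]
  have h6 := eq_sum_pd_add_normal (X.injective_fderiv θ hθ) hν.1 (hν.inner_pd hk hθ) V
  rw [h5, zero_smul, add_zero, Finset.sum_comm] at h6
  set c : Coord n := WithLp.toLp 2 fun j =>
    ∑ i, (inducedMetric X.map θ)⁻¹ i j * inner ℝ V (pd i X.map θ) with hc
  have h7 : V = fderiv ℝ X.map θ c := by
    rw [fderiv_eq_sum_pd]
    refine h6.trans (Finset.sum_congr rfl fun j _ => ?_)
    rw [← Finset.sum_smul]
  have h8 : fderiv ℝ (z ∘ X.map) θ c = 0 := by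
    rw [← X.fderivWithin_apply_fderiv hk hθ hz, ← h7]
    have h9 := tangentialGradient_mulVec (S := S) (ν := ν) (f := z) (y := X.map θ) V
    rw [real_inner_comm, h5, zero_smul, sub_zero] at h9
    ext β
    rw [← h9]
    exact congr_fun h3 β
  have h10 : c = 0 := hinj (by rw [h8, map_zero])
  rw [h10, map_zero] at h7
  exact hv0 (by simpa [hV] using h7)

/-! ### Integration on a compact hypersurface -/

/-- By compactness a local bound suffices. A parametrization is Lipschitz on a small closed ball,
whose `n`-dimensional Hausdorff measure in `ℝⁿ` is finite, being a Haar measure. -/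
theorem IsHypersurface.isFiniteMeasure {n : ℕ} {k : WithTop ℕ∞} {S : Set (Amb n)}
    (hS : IsHypersurface n k S) (hk : 1 ≤ k) (hc : IsCompact S) :
    IsFiniteMeasure (surfaceMeasure S) := by
  refine ⟨?_⟩
  rw [surfaceMeasure, Measure.restrict_apply_univ]
  refine hc.measure_lt_top_of_nhdsWithin fun y hy => ?_
  obtain ⟨X, θ, hθ, rfl⟩ := hS y hy
  obtain ⟨K, t, ht, hK⟩ := ((X.contDiffAt hθ).of_le hk).exists_lipschitzOnWith
  obtain ⟨r, hr, hrt⟩ := Metric.nhds_basis_closedBall.mem_iff.1 ht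
  refine ⟨X.map '' Metric.closedBall θ r,
    X.image_mem_nhdsWithin (Metric.closedBall_mem_nhds θ hr) hθ, ?_⟩
  have h1 : (μH[(n : ℝ)] : Measure (Coord n)) (Metric.closedBall θ r) < ⊤ := by
    have h := (isAddHaarMeasure_hausdorffMeasure (E := Coord n)).lt_top_of_isCompact
      (isCompact_closedBall θ r)
    rwa [finrank_euclideanSpace_fin] at h
  have h2 := (hK.mono hrt).hausdorffMeasure_image_le (d := (n : ℝ)) n.cast_nonneg
  have h3 : (μH[(n : ℝ)] : Measure (Amb n)) (X.map '' Metric.closedBall θ r) < ⊤ :=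
    h2.trans_lt (ENNReal.mul_lt_top (ENNReal.rpow_lt_top_of_nonneg n.cast_nonneg
      ENNReal.coe_ne_top) h1)
  rw [Measure.euclideanHausdorffMeasure_def, Measure.smul_apply, ENNReal.smul_def]
  exact ENNReal.mul_lt_top ENNReal.coe_lt_top h3

section Integrable

variable {n : ℕ} {S : Set (Amb n)}

theorem ContinuousOn.memLp_surfaceMeasure {E : Type*} [NormedAddCommGroup E]
    [SecondCountableTopology E] {F : Amb n → E} (hF : ContinuousOn F S)
    (hc : IsCompact S) [IsFiniteMeasure (surfaceMeasure S)] : MemLp F 2 (surfaceMeasure S) := by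
  obtain ⟨C, hC⟩ := hc.exists_bound_of_continuousOn hF
  exact MemLp.of_bound (hF.aestronglyMeasurable hc.measurableSet) C
    (ae_restrict_of_forall_mem hc.measurableSet hC)

theorem MeasureTheory.MemLp.integrable_inner_amb {μ : Measure (Amb n)} {F G : Amb n → Amb n}
    (hF : MemLp F 2 μ) (hG : MemLp G 2 μ) : Integrable (fun y => inner ℝ (F y) (G y)) μ := by
  have h : ∀ {H : Amb n → Amb n}, MemLp H 2 μ → ∀ i, MemLp (fun y => H y i) 2 μ := fun hH i =>
    (EuclideanSpace.proj i : Amb n →L[ℝ] ℝ).comp_memLp' hH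
  simp only [PiLp.inner_apply]
  exact integrable_finsetSum _ fun i _ => (h hG i).integrable_mul (h hF i)

theorem integrable_frobProd {μ : Measure (Amb n)}
    {A B : Amb n → Matrix (Fin (n + 1)) (Fin (n + 1)) ℝ}
    (hA : ∀ β γ, MemLp (fun y => A y β γ) 2 μ) (hB : ∀ β γ, MemLp (fun y => B y β γ) 2 μ) :
    Integrable (fun y => frobProd (A y) (B y)) μ :=
  integrable_finsetSum _ fun β _ => integrable_finsetSum _ fun γ _ =>
    (hA β γ).integrable_mul (hB β γ)

variable {ν f η : Amb n → Amb n} {Dη : Amb n → Matrix (Fin (n + 1)) (Fin (n + 1)) ℝ}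

theorem IsSobolevH12.integrable_inner (hη : IsSobolevH12 S ν η Dη) (hc : IsCompact S)
    [IsFiniteMeasure (surfaceMeasure S)] {F : Amb n → Amb n} (hF : ContinuousOn F S) :
    Integrable (fun y => inner ℝ (F y) (η y)) (surfaceMeasure S) :=
  (hF.memLp_surfaceMeasure hc).integrable_inner_amb hη.memLp

theorem IsSobolevH12.integrable_frobProd (hη : IsSobolevH12 S ν η Dη) (hc : IsCompact S)
    [IsFiniteMeasure (surfaceMeasure S)] {A : Amb n → Matrix (Fin (n + 1)) (Fin (n + 1)) ℝ}
    (hA : ContinuousOn A S) :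
    Integrable (fun y => frobProd (A y) (Dη y)) (surfaceMeasure S) := by
  refine _root_.integrable_frobProd (fun β γ => ?_) hη.memLp_grad
  exact ContinuousOn.memLp_surfaceMeasure
    (continuousOn_pi.1 (continuousOn_pi.1 hA β) γ) hc

/-- Green's formula `∫ Δ_S f · η + ∫ ∇_S f : ∇_S η = 0`. -/
theorem IsSobolevH12.integral_surfaceLaplacian {k : WithTop ℕ∞} (hη : IsSobolevH12 S ν η Dη)
    (hS : IsHypersurface n k S) (hk : 2 ≤ k) (hc : IsCompact S)
    (hν : ∀ y ∈ S, IsUnitNormalAt S y (ν y)) (hf : ContDiffOn ℝ 2 f S) :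
    ∫ y, inner ℝ (surfaceLaplacian S ν f y) (η y) ∂(surfaceMeasure S)
      + ∫ y, frobProd (tangentialGradient S ν f y) (Dη y) ∂(surfaceMeasure S) = 0 := by
  have hk1 : (1 : WithTop ℕ∞) ≤ k := le_trans (by norm_num) hk
  have h11 : (1 : WithTop ℕ∞) + 1 = 2 := by norm_num
  have := hS.isFiniteMeasure hk1 hc
  have hrow : ∀ β, ContDiffOn ℝ 1 (tangentialGradientRow S ν f β) S := fun β =>
    hS.contDiffOn_tangentialGradientRow (m := 1) (h11 ▸ hk) hν (h11 ▸ hf) β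
  -- The test fields are the rows of `∇_S f`: tangential, and of class `C¹` because `f` and `S` are
  -- `C²`.
  have hw := fun β => hη.weak β _ (hrow β) fun y hy =>
    inner_tangentialGradientRow_normal (hν y hy).1 β
  have hL := (hS.continuousOn_surfaceLaplacian hk hν hf).memLp_surfaceMeasure hc
  have hcomp : ∀ {H : Amb n → Amb n}, MemLp H 2 (surfaceMeasure S) →
      ∀ i, MemLp (fun y => H y i) 2 (surfaceMeasure S) := fun hH i =>
    (EuclideanSpace.proj i : Amb n →L[ℝ] ℝ).comp_memLp' hH
  have e1 : ∫ y, inner ℝ (surfaceLaplacian S ν f y) (η y) ∂(surfaceMeasure S)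
      = ∑ β, ∫ y, η y β * (tangentialGradient S ν (tangentialGradientRow S ν f β) y).trace
          ∂(surfaceMeasure S) := by
    rw [← integral_finsetSum]
    · simp [PiLp.inner_apply, surfaceLaplacian]
    · exact fun β _ => (hcomp hη.memLp β).integrable_mul (hcomp hL β)
  have e2 : ∫ y, frobProd (tangentialGradient S ν f y) (Dη y) ∂(surfaceMeasure S)
      = ∑ β, ∫ y, ∑ γ, Dη y β γ * tangentialGradientRow S ν f β y γ ∂(surfaceMeasure S) := by
    rw [← integral_finsetSum]
    · simp [frobProd, tangentialGradientRow, mul_comm]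
    · intro β _
      exact integrable_finsetSum _ fun γ _ => (hη.memLp_grad β γ).integrable_mul
        (hcomp ((hrow β).continuousOn.memLp_surfaceMeasure hc) γ)
  rw [e1, e2, ← Finset.sum_add_distrib]
  exact Finset.sum_eq_zero fun β _ => by rw [hw β, neg_add_cancel]

end Integrable

/-! ### The map Laplacian in local coordinates -/

section Coordinates

variable {n : ℕ} {θ : Coord n}

theorem pd_eventuallyEq {W : Type*} [NormedAddCommGroup W] [NormedSpace ℝ W] {F G : Coord n → W}
    (h : F =ᶠ[𝓝 θ] G) (i : Fin n) : pd i F =ᶠ[𝓝 θ] pd i G :=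
  (eventually_eventually_nhds.2 h).mono fun _ h' => pd_congr h' i

theorem laplaceCoord_congr {W : Type*} [NormedAddCommGroup W] [NormedSpace ℝ W]
    {F G : Coord n → W} (g : Coord n → Matrix (Fin n) (Fin n) ℝ) (h : F =ᶠ[𝓝 θ] G) :
    laplaceCoord g F θ = laplaceCoord g G θ := by
  simp only [laplaceCoord, pd_congr h, pd_congr (pd_eventuallyEq h _)]

/-- Gauss's formula: the tangential part of `∂_i ∂_j Y` is `Γ^k_{ij} ∂_k Y`. -/
theorem sum_christoffel_mul_inner {Y : Coord n → Amb n} (hY : ContDiffAt ℝ 2 Y θ)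
    (hinj : Function.Injective (fderiv ℝ Y θ)) (i j l : Fin n) :
    ∑ k, christoffel (inducedMetric Y) k i j θ * inner ℝ (pd k Y θ) (pd l Y θ)
      = inner ℝ (pd i (pd j Y) θ) (pd l Y θ) := by
  simp only [christoffel_inducedMetric hY, Finset.sum_mul]
  rw [Finset.sum_comm]
  have : ∀ a, ∑ k, (inducedMetric Y θ)⁻¹ k a * inner ℝ (pd i (pd j Y) θ) (pd a Y θ)
      * inner ℝ (pd k Y θ) (pd l Y θ)
      = (if a = l then 1 else 0) * inner ℝ (pd i (pd j Y) θ) (pd a Y θ) := by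
    intro a
    rw [← sum_inv_inducedMetric_mul hinj a l, Finset.sum_mul]
    refine Finset.sum_congr rfl fun k _ => ?_
    rw [inv_inducedMetric_comm Y θ k a]
    ring
  simp [this]

/-- The Laplacian of an immersion is the mean curvature vector. -/
theorem laplaceCoord_self {Y : Coord n → Amb n} (hY : ContDiffAt ℝ 2 Y θ)
    (hinj : Function.Injective (fderiv ℝ Y θ)) {N : Amb n} (hN : ‖N‖ = 1)
    (hNY : ∀ i, inner ℝ N (pd i Y θ) = 0) :
    laplaceCoord (inducedMetric Y) Y θ = -(meanCurvature Y N θ • N) := by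
  -- By Gauss's formula the tangential components of the Laplacian vanish; in the normal component
  -- the Christoffel terms drop out.
  have h := eq_smul_of_inner_pd_eq_zero hinj hN hNY (r := laplaceCoord (inducedMetric Y) Y θ) ?_
  · rw [h]
    rw [← neg_smul]
    congr 1
    simp only [laplaceCoord, meanCurvature, neg_neg, sum_inner, inner_smul_left, inner_sub_left,
      RCLike.conj_to_real]
    simp [real_inner_comm N, hNY]
  · intro l
    simp only [laplaceCoord, sum_inner, inner_smul_left, inner_sub_left, RCLike.conj_to_real,
      sum_christoffel_mul_inner hY hinj, sub_self, mul_zero, Finset.sum_const_zero]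

theorem pd_comp {Y : Coord n → Amb n} {Ψ : Coord n → Coord n}
    (hY : DifferentiableAt ℝ Y (Ψ θ)) (hΨ : DifferentiableAt ℝ Ψ θ) (i : Fin n) :
    pd i (fun θ' => Y (Ψ θ')) θ = ∑ a, pd i (fun θ' => Ψ θ' a) θ • pd a Y (Ψ θ) := by
  have h : pd i (fun θ' => Y (Ψ θ')) θ = fderiv ℝ Y (Ψ θ) (pd i Ψ θ) := by
    have := (hY.hasFDerivAt.comp θ hΨ.hasFDerivAt).fderiv
    exact congrArg (fun L => L (EuclideanSpace.single i 1)) this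
  rw [h, fderiv_eq_sum_pd]
  exact Finset.sum_congr rfl fun a _ => by rw [pd_apply hΨ]

theorem pd_pd_comp {Y : Coord n → Amb n} {Ψ : Coord n → Coord n}
    (hY : ContDiffAt ℝ 2 Y (Ψ θ)) (hΨ : ContDiffAt ℝ 2 Ψ θ) (i j : Fin n) :
    pd i (pd j (fun θ' => Y (Ψ θ'))) θ
      = ∑ a, (pd i (pd j (fun θ' => Ψ θ' a)) θ • pd a Y (Ψ θ)
        + pd j (fun θ' => Ψ θ' a) θ • ∑ b, pd i (fun θ' => Ψ θ' b) θ • pd b (pd a Y) (Ψ θ)) := by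
  -- The first-order chain rule is needed on a whole neighbourhood, so that it can be differentiated
  -- again.
  have hev : pd j (fun θ' => Y (Ψ θ'))
      =ᶠ[𝓝 θ] fun θ' => ∑ a, pd j (fun θ' => Ψ θ' a) θ' • pd a Y (Ψ θ') := by
    have h1 := hΨ.continuousAt.eventually
      ((hY.eventually (by simp)).mono fun _ h => h.differentiableAt (by norm_num))
    have h2 := (hΨ.eventually (by simp)).mono fun _ h => h.differentiableAt (by norm_num)
    filter_upwards [h1, h2] with θ' h1 h2
    exact pd_comp h1 h2 j
  have hΨa : ∀ a, ContDiffAt ℝ 2 (fun θ' => Ψ θ' a) θ := fun a =>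
    (contDiffAt_piLp_apply (p := 2)).comp θ hΨ
  have hΨd := hΨ.differentiableAt (by norm_num)
  have hYa : ∀ a, DifferentiableAt ℝ (fun θ' => pd a Y (Ψ θ')) θ := fun a =>
    (hY.differentiableAt_pd a).comp θ hΨd
  have hΨj : ∀ a, DifferentiableAt ℝ (fun θ' => pd j (fun θ' => Ψ θ' a) θ') θ := fun a =>
    (hΨa a).differentiableAt_pd j
  have hs : ∀ a ∈ Finset.univ, DifferentiableAt ℝ
      (fun θ' => pd j (fun θ' => Ψ θ' a) θ' • pd a Y (Ψ θ')) θ := fun a _ =>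
    (hΨj a).smul (hYa a)
  rw [pd_congr hev, pd, fderiv_fun_sum hs, sum_apply]
  refine Finset.sum_congr rfl fun a _ => ?_
  rw [fderiv_fun_smul (hΨj a) (hYa a)]
  simp only [add_apply, smul_apply,
    ContinuousLinearMap.smulRight_apply]
  rw [add_comm]
  congr 2
  exact pd_comp (hY.differentiableAt_pd a) hΨd i

/-- The map Laplacian `Δ_{g,h} Ψ` is the tangential part of the Laplacian of `Y ∘ Ψ`, if `h` is
induced by `Y`. -/
theorem inner_laplaceCoord_comp {Y : Coord n → Amb n} {Ψ : Coord n → Coord n}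
    (hY : ContDiffAt ℝ 2 Y (Ψ θ)) (hinj : Function.Injective (fderiv ℝ Y (Ψ θ)))
    (hΨ : ContDiffAt ℝ 2 Ψ θ) (g : Coord n → Matrix (Fin n) (Fin n) ℝ) (l : Fin n) :
    inner ℝ (laplaceCoord g (fun θ' => Y (Ψ θ')) θ) (pd l Y (Ψ θ))
      = inner ℝ (∑ q, mapLaplaceCoord g (inducedMetric Y) Ψ q θ • pd q Y (Ψ θ))
          (pd l Y (Ψ θ)) := by
  have hYd := hY.differentiableAt (by norm_num)
  have hΨd := hΨ.differentiableAt (by norm_num)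
  simp only [laplaceCoord, mapLaplaceCoord, pd_pd_comp hY hΨ, pd_comp hYd hΨd, sum_inner,
    inner_smul_left, inner_sub_left, inner_add_left, RCLike.conj_to_real]
  simp only [Finset.sum_mul]
  rw [Finset.sum_comm' (t' := Finset.univ) (s' := fun _ => Finset.univ) (by simp)]
  conv_rhs =>
    rw [Finset.sum_comm]
    enter [2, i]
    rw [Finset.sum_comm]
  rw [Finset.sum_comm]
  refine Finset.sum_congr rfl fun i _ => Finset.sum_congr rfl fun j _ => ?_
  -- Gauss's formula for `Y`: the quadratic term of the map Laplacian is the tangential part of the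
  -- second derivatives of `Y`.
  have e : ∑ q, (∑ a, ∑ b, christoffel (inducedMetric Y) q a b (Ψ θ)
        * pd i (fun θ' => Ψ θ' a) θ * pd j (fun θ' => Ψ θ' b) θ)
        * inner ℝ (pd q Y (Ψ θ)) (pd l Y (Ψ θ))
      = ∑ a, pd j (fun θ' => Ψ θ' a) θ * ∑ b, pd i (fun θ' => Ψ θ' b) θ
        * inner ℝ (pd b (pd a Y) (Ψ θ)) (pd l Y (Ψ θ)) := by
    simp only [← sum_christoffel_mul_inner hY hinj, Finset.sum_mul, Finset.mul_sum]
    rw [Finset.sum_comm, Finset.sum_congr rfl fun a _ => Finset.sum_comm, Finset.sum_comm]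
    refine Finset.sum_congr rfl fun b _ => Finset.sum_congr rfl fun a _ =>
      Finset.sum_congr rfl fun q _ => by ring
  have e2 : ∑ k, christoffel g k i j θ * ∑ a, pd k (fun θ' => Ψ θ' a) θ
        * inner ℝ (pd a Y (Ψ θ)) (pd l Y (Ψ θ))
      = ∑ q, (∑ k, christoffel g k i j θ * pd k (fun θ' => Ψ θ' q) θ)
        * inner ℝ (pd q Y (Ψ θ)) (pd l Y (Ψ θ)) := by
    simp only [Finset.sum_mul, Finset.mul_sum]
    rw [Finset.sum_comm]
    refine Finset.sum_congr rfl fun b _ => Finset.sum_congr rfl fun a _ => by ring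
  rw [Finset.sum_add_distrib, ← e, e2, ← Finset.sum_add_distrib, ← Finset.sum_sub_distrib,
    Finset.mul_sum]
  exact Finset.sum_congr rfl fun q _ => by ring

end Coordinates

/-! ### Embedded images of a compact hypersurface -/

theorem two_le_infty : (2 : WithTop ℕ∞) ≤ ∞ := WithTop.coe_le_coe.2 (le_top : (2 : ℕ∞) ≤ ⊤)

/-- The local parametrization of `y(M)` belonging to one of `M`. -/
noncomputable def LocalParam.pushforward {n : ℕ} {M : Set (Amb n)} (φ : LocalParam n ∞ M)
    (y : Amb n → Amb n) (hy : ContDiffOn ℝ 2 y M) (hinj : InjOn y M) (hM : IsCompact M)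
    (himm : ∀ θ ∈ φ.dom, Function.Injective (fderiv ℝ (y ∘ φ.map) θ)) {S : Set (Amb n)}
    (hS : y '' M = S) : LocalParam n 2 S where
  dom := φ.dom
  map := y ∘ φ.map
  isOpen_dom := φ.isOpen_dom
  contDiffOn := hy.comp (φ.contDiffOn.of_le two_le_infty) φ.mapsTo
  injective_fderiv := himm
  injOn := hinj.comp φ.injOn φ.mapsTo
  image_open := by
    subst hS
    intro W hW hWo
    obtain ⟨U, hU, hWU⟩ := φ.image_open W hW hWo
    have : CompactSpace M := isCompact_iff_compactSpace.1 hM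
    -- A continuous injection of a compact space is a closed embedding, so relatively open sets of
    -- `M` go to relatively open sets of the image.
    have he : Topology.IsClosedEmbedding (M.domRestrict y) :=
      (continuousOn_iff_continuous_domRestrict.1 hy.continuousOn).isClosedEmbedding
        (injOn_iff_injective.1 hinj)
    obtain ⟨V, hV, hVU⟩ := he.isInducing.isOpen_iff.1 (hU.preimage continuous_subtype_val)
    refine ⟨V, hV, ?_⟩
    rw [image_comp, hWU]
    have hmem : ∀ p ∈ M, y p ∈ V ↔ p ∈ U := fun p hp => by
      have := congrArg (fun s => (⟨p, hp⟩ : M) ∈ s) hVU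
      exact iff_of_eq this
    ext q
    constructor
    · rintro ⟨p, ⟨hp, hpU⟩, rfl⟩
      exact ⟨mem_image_of_mem _ hp, (hmem p hp).2 hpU⟩
    · rintro ⟨⟨p, hp, rfl⟩, hpV⟩
      exact ⟨p, ⟨hp, (hmem p hp).1 hpV⟩, rfl⟩

theorem IsHypersurface.image {n : ℕ} {M : Set (Amb n)} (hM : IsHypersurface n ∞ M)
    (hc : IsCompact M) {y : Amb n → Amb n} (hy : ContDiffOn ℝ 2 y M) (hinj : InjOn y M)
    (himm : ∀ φ : LocalParam n ∞ M, ∀ θ ∈ φ.dom,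
      Function.Injective (fderiv ℝ (y ∘ φ.map) θ)) : IsHypersurface n 2 (y '' M) := by
  rintro _ ⟨p, hp, rfl⟩
  obtain ⟨φ, θ, hθ, rfl⟩ := hM p hp
  exact ⟨φ.pushforward y hy hinj hc (himm φ) rfl, θ, hθ, rfl⟩

section Embedding

variable {n : ℕ} {M : Set (Amb n)} {y : Amb n → Amb n}

theorem invFunOn_comp_eventuallyEq (hinj : InjOn y M) (φ : LocalParam n ∞ M) {θ : Coord n} (hθ : θ ∈ φ.dom) :
    Function.invFunOn y M ∘ (y ∘ φ.map) =ᶠ[𝓝 θ] φ.map := by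
  filter_upwards [φ.isOpen_dom.mem_nhds hθ] with θ' hθ'
  exact hinj.leftInvOn_invFunOn (φ.map_mem hθ')

/-- The inverse of an embedding of class `C²` is of class `C²`. -/
theorem contDiffOn_invFunOn_image
    (hM : IsHypersurface n ∞ M) (hc : IsCompact M) (hy : ContDiffOn ℝ 2 y M) (hinj : InjOn y M)
    (himm : ∀ φ : LocalParam n ∞ M, ∀ θ ∈ φ.dom, Function.Injective (fderiv ℝ (y ∘ φ.map) θ)) :
    ContDiffOn ℝ 2 (Function.invFunOn y M) (y '' M) := by
  rintro _ ⟨p, hp, rfl⟩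
  obtain ⟨φ, θ, hθ, rfl⟩ := hM p hp
  refine (φ.pushforward y hy hinj hc (himm φ) rfl).contDiffWithinAt_of_comp (by norm_num) le_rfl hθ ?_
  exact ((φ.contDiffAt hθ).of_le two_le_infty).congr_of_eventuallyEq
    (invFunOn_comp_eventuallyEq hinj φ hθ)

/-- The Laplacian of `id_M` with respect to the metric induced by `y` corresponds to the
Laplacian of the inverse of `y` on `y(M)`. -/
theorem laplacian_id_eq_surfaceLaplacian
    (hM : IsHypersurface n ∞ M) (hc : IsCompact M) (hy : ContDiffOn ℝ 2 y M) (hinj : InjOn y M)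
    (himm : ∀ φ : LocalParam n ∞ M, ∀ θ ∈ φ.dom, Function.Injective (fderiv ℝ (y ∘ φ.map) θ))
    {ν : Amb n → Amb n}
    (hν : ∀ q ∈ y '' M, IsUnitNormalAt (y '' M) q (ν q)) {p : Amb n} (hp : p ∈ M) :
    laplacian M y id p = surfaceLaplacian (y '' M) ν (Function.invFunOn y M) (y p) := by
  have hex : ∃ L, ∃ φ : LocalParam n ∞ M, ∃ θ ∈ φ.dom, φ.map θ = p ∧
      L = laplaceCoord (inducedMetric (y ∘ φ.map)) (id ∘ φ.map) θ := by
    obtain ⟨φ, θ, hθ, h⟩ := hM p hp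
    exact ⟨_, φ, θ, hθ, h, rfl⟩
  -- The chart selected by `epsilon` is unknown. Any chart will do, since `surfaceLaplacian_map`
  -- holds in all of them and `y ∘ φ.map` parametrizes `y(M)` with the same metric.
  obtain ⟨φ, θ, hθ, rfl, h⟩ := Classical.epsilon_spec hex
  refine h.trans (Eq.trans ?_ ((φ.pushforward y hy hinj hc (himm φ) rfl).surfaceLaplacian_map le_rfl
    hν (contDiffOn_invFunOn_image hM hc hy hinj himm) hθ).symm)
  exact (laplaceCoord_congr _ (invFunOn_comp_eventuallyEq hinj φ hθ)).symm

end Embedding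

/-! ### The flows -/

section Flow

variable {n : ℕ} {α T : ℝ} {M : Set (Amb n)} {x ψ : ℝ → Amb n → Amb n} {t : ℝ}

theorem ContDiffOn.slice {k : WithTop ℕ∞} {F : ℝ → Amb n → Amb n}
    (hF : ContDiffOn ℝ k (fun q : ℝ × Amb n => F q.1 q.2) (Ico 0 T ×ˢ M)) (ht : t ∈ Ico 0 T) :
    ContDiffOn ℝ k (F t) M :=
  hF.comp (contDiff_prodMk_right t).contDiffOn fun _ hp => ⟨ht, hp⟩

namespace IsMeanCurvatureFlow

theorem injOn (hx : IsMeanCurvatureFlow M T x) (ht : t ∈ Ico 0 T) : InjOn (x t) M :=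
  injOn_iff_injective.2 (hx.embedding t ht).injective

end IsMeanCurvatureFlow

namespace IsHarmonicMapHeatFlow

theorem inv_mem (hψ : IsHarmonicMapHeatFlow M T α x ψ) (ht : t ∈ Ico 0 T) {p : Amb n}
    (hp : p ∈ M) : Function.invFunOn (ψ t) M p ∈ M :=
  (hψ.bijOn t ht).surjOn.mapsTo_invFunOn hp

theorem apply_inv (hψ : IsHarmonicMapHeatFlow M T α x ψ) (ht : t ∈ Ico 0 T) {p : Amb n}
    (hp : p ∈ M) : ψ t (Function.invFunOn (ψ t) M p) = p :=
  (hψ.bijOn t ht).surjOn.rightInvOn_invFunOn hp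

theorem inv_apply (hψ : IsHarmonicMapHeatFlow M T α x ψ) (ht : t ∈ Ico 0 T) {p : Amb n}
    (hp : p ∈ M) : Function.invFunOn (ψ t) M (ψ t p) = p :=
  (hψ.bijOn t ht).injOn.leftInvOn_invFunOn hp

theorem deTurckFlow_apply (hψ : IsHarmonicMapHeatFlow M T α x ψ) (ht : t ∈ Ico 0 T) {p : Amb n}
    (hp : p ∈ M) : deTurckFlow M x ψ t (ψ t p) = x t p := by
  rw [deTurckFlow, hψ.inv_apply ht hp]

theorem image_deTurckFlow (hψ : IsHarmonicMapHeatFlow M T α x ψ) (ht : t ∈ Ico 0 T) :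
    deTurckFlow M x ψ t '' M = x t '' M := by
  rw [← congrArg (image (deTurckFlow M x ψ t)) (hψ.bijOn t ht).image_eq, ← image_comp]
  exact image_congr fun p hp => hψ.deTurckFlow_apply ht hp

theorem injOn_deTurckFlow (hψ : IsHarmonicMapHeatFlow M T α x ψ)
    (hx : IsMeanCurvatureFlow M T x) (ht : t ∈ Ico 0 T) : InjOn (deTurckFlow M x ψ t) M := by
  intro p hp q hq h
  have := hx.injOn ht (hψ.inv_mem ht hp) (hψ.inv_mem ht hq) h
  rw [← hψ.apply_inv ht hp, ← hψ.apply_inv ht hq, this]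

theorem contDiffOn_deTurckFlow (hψ : IsHarmonicMapHeatFlow M T α x ψ)
    (hx : IsMeanCurvatureFlow M T x) :
    ContDiffOn ℝ 2 (fun q : ℝ × Amb n => deTurckFlow M x ψ q.1 q.2) (Ico 0 T ×ˢ M) :=
  hx.contDiffOn.comp (contDiffOn_fst.prodMk hψ.contDiffOn_inv) fun _ hq =>
    ⟨hq.1, hψ.inv_mem hq.1 hq.2⟩

/-- Let `κ` be `ψ(t)⁻¹` in coordinates. Since `φ.map = (ψ ∘ φ₁.map) ∘ κ` is an immersion, `dκ` is
injective; then so is the derivative of `x̂ ∘ φ.map = (x ∘ φ₁.map) ∘ κ`. -/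
theorem injective_fderiv_deTurckFlow (hM : IsHypersurface n ∞ M)
    (hψ : IsHarmonicMapHeatFlow M T α x ψ)
    (hx : IsMeanCurvatureFlow M T x) (ht : t ∈ Ico 0 T) (φ : LocalParam n ∞ M) (θ : Coord n)
    (hθ : θ ∈ φ.dom) : Function.Injective (fderiv ℝ (deTurckFlow M x ψ t ∘ φ.map) θ) := by
  have h2 := two_le_infty
  set ι := Function.invFunOn (ψ t) M with hι
  have hιC : ContDiffOn ℝ 2 ι M :=
    ContDiffOn.slice (F := fun t => Function.invFunOn (ψ t) M) hψ.contDiffOn_inv ht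
  have hιφ : ContDiffAt ℝ 2 (ι ∘ φ.map) θ := φ.contDiffAt_comp h2 hιC hθ
  have hmem : ∀ {θ'}, θ' ∈ φ.dom → ι (φ.map θ') ∈ M := fun h => hψ.inv_mem ht (φ.map_mem h)
  obtain ⟨φ₁, θ₁, hθ₁, e⟩ := hM _ (hmem hθ)
  have hκ : ContDiffAt ℝ 2 (φ₁.chart ∘ (ι ∘ φ.map)) θ := by
    have hc := (φ₁.contDiffWithinAt_chart (by simp) hθ₁).of_le h2
    rw [e] at hc
    exact (hc.comp θ (hιφ.contDiffWithinAt (s := φ.dom)) fun θ' h => hmem h).contDiffAt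
      (φ.isOpen_dom.mem_nhds hθ)
  set κ := φ₁.chart ∘ (ι ∘ φ.map) with hκdef
  have hκθ : κ θ = θ₁ := by
    rw [hκdef, Function.comp_apply, Function.comp_apply, ← e, φ₁.chart_map hθ₁]
  have hev : ∀ᶠ θ' in 𝓝 θ, φ₁.map (κ θ') = ι (φ.map θ') ∧ κ θ' ∈ φ₁.dom := by
    have h1 : Tendsto (ι ∘ φ.map) (𝓝 θ) (𝓝[M] (ι (φ.map θ))) :=
      tendsto_nhdsWithin_iff.2 ⟨hιφ.continuousAt, by
        filter_upwards [φ.isOpen_dom.mem_nhds hθ] with θ' h using hmem h⟩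
    have h3 := φ₁.image_dom_mem_nhdsWithin hθ₁
    rw [e] at h3
    filter_upwards [h1 h3] with θ' h
    exact ⟨φ₁.map_chart h, φ₁.chart_mem h⟩
  have hψφ₁ : DifferentiableAt ℝ (ψ t ∘ φ₁.map) (κ θ) := by
    rw [hκθ]
    exact (φ₁.contDiffAt_comp h2 (ContDiffOn.slice hψ.contDiffOn ht) hθ₁).differentiableAt
      (by norm_num)
  have hxφ₁ : DifferentiableAt ℝ (x t ∘ φ₁.map) (κ θ) := by
    rw [hκθ]
    exact (φ₁.contDiffAt_comp h2 (ContDiffOn.slice hx.contDiffOn ht) hθ₁).differentiableAt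
      (by norm_num)
  have hκd := hκ.differentiableAt (by norm_num)
  have e1 : φ.map =ᶠ[𝓝 θ] (ψ t ∘ φ₁.map) ∘ κ := by
    filter_upwards [hev, φ.isOpen_dom.mem_nhds hθ] with θ' h h'
    simp only [Function.comp_apply]
    rw [h.1, hψ.apply_inv ht (φ.map_mem h')]
  have e2 : deTurckFlow M x ψ t ∘ φ.map =ᶠ[𝓝 θ] (x t ∘ φ₁.map) ∘ κ := by
    filter_upwards [hev] with θ' h
    simp only [Function.comp_apply, deTurckFlow]
    rw [h.1]
  have hκinj : Function.Injective (fderiv ℝ κ θ) := by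
    have h := φ.injective_fderiv θ hθ
    rw [e1.fderiv_eq, fderiv_comp θ hψφ₁ hκd] at h
    exact Function.Injective.of_comp h
  have hxinj : Function.Injective (fderiv ℝ (x t ∘ φ₁.map) (κ θ)) := by
    rw [hκθ]
    exact hx.immersion t ht φ₁ θ₁ hθ₁
  rw [e2.fderiv_eq, fderiv_comp θ hxφ₁ hκd]
  exact hxinj.comp hκinj

end IsHarmonicMapHeatFlow

end Flow

/-! ### The pointwise equation of the mean curvature-DeTurck flow -/

/-- In coordinates `(∇_S f)ᵀ D` is a combination of the products `D · ∂_j f`. For `f = z` it thus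
kills the vectors normal to `M`. -/
theorem LocalParam.transpose_tangentialGradient_mulVec_eq_zero {n : ℕ} {k : WithTop ℕ∞}
    {S : Set (Amb n)} (X : LocalParam n k S) (hk : 1 ≤ k) {θ : Coord n} (hθ : θ ∈ X.dom)
    {ν f : Amb n → Amb n} (hν : IsUnitNormalAt S (X.map θ) (ν (X.map θ)))
    (hf : DifferentiableWithinAt ℝ f S (X.map θ)) {D : Amb n}
    (hD : ∀ j, inner ℝ D (pd j (f ∘ X.map) θ) = 0) :
    (tangentialGradient S ν f (X.map θ))ᵀ *ᵥ D.ofLp = 0 := by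
  ext γ
  simp only [Matrix.mulVec, dotProduct, Matrix.transpose_apply,
    X.tangentialGradient_map hk hθ hν hf, Finset.sum_mul, Pi.zero_apply]
  rw [Finset.sum_comm]
  refine Finset.sum_eq_zero fun i _ => ?_
  rw [Finset.sum_comm]
  refine Finset.sum_eq_zero fun j _ => ?_
  have h := hD j
  rw [PiLp.inner_apply] at h
  simp only [mul_assoc, ← Finset.mul_sum]
  refine mul_eq_zero_of_right _ (mul_eq_zero_of_right _ (Eq.trans ?_ h))
  simp

/-- The equation of the mean curvature-DeTurck flow on `S = Γ(t)`: the mean curvature vector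
`Δ_S id` is normal and decomposes into the velocity and a tangential vector `τ / α` with
`Ĥ τ = (∇_S z)ᵀ Δ_S z`. -/
theorem deTurckFlow_equation {n : ℕ} {α T : ℝ} {M : Set (Amb n)} {x ψ : ℝ → Amb n → Amb n}
    {t : ℝ} (hM : IsHypersurface n ∞ M) (hc : IsCompact M)
    (hx : IsMeanCurvatureFlow M T x) (hψ : IsHarmonicMapHeatFlow M T α x ψ) (ht : t ∈ Ico 0 T)
    {S : Set (Amb n)} (hS : deTurckFlow M x ψ t '' M = S)
    {ν z : Amb n → Amb n} (hν : ∀ y ∈ S, IsUnitNormalAt S y (ν y))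
    (hz : z = Function.invFunOn (deTurckFlow M x ψ t) M) {y : Amb n} (hy : y ∈ S) :
    DifferentiableWithinAt ℝ (fun s => deTurckFlow M x ψ s (z y)) (Ico 0 T) t ∧
    IsUnit (metricRep S ν z y).det ∧
    surfaceLaplacian S ν (fun y => y) y
      = inner ℝ (surfaceLaplacian S ν (fun y => y) y) (ν y) • ν y ∧
    ∃ τ : Amb n, inner ℝ (ν y) τ = 0 ∧
      surfaceLaplacian S ν (fun y => y) y
        = derivWithin (fun s => deTurckFlow M x ψ s (z y)) (Ico 0 T) t + α⁻¹ • τ ∧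
      metricRep S ν z y *ᵥ τ.ofLp
        = (tangentialGradient S ν z y)ᵀ *ᵥ (surfaceLaplacian S ν z y).ofLp := by
  have hSx : x t '' M = S := by rw [← hS, hψ.image_deTurckFlow ht]
  have hx2 := hx.contDiffOn.slice ht
  have hψ2 := hψ.contDiffOn.slice ht
  have hh2 := (hψ.contDiffOn_deTurckFlow hx).slice ht
  have hhinj := hψ.injOn_deTurckFlow hx ht
  have hhimm := hψ.injective_fderiv_deTurckFlow hM hx ht
  have hz2 : ContDiffOn ℝ 2 z S := by
    rw [hz, ← hS]
    exact contDiffOn_invFunOn_image hM hc hh2 hhinj hhimm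
  have hzd := hz2.differentiableOn (by norm_num)
  have hzh : ∀ p ∈ M, z (deTurckFlow M x ψ t p) = p := fun p hp => by
    rw [hz]
    exact hhinj.leftInvOn_invFunOn hp
  have hy' := hy
  rw [← hSx] at hy'
  obtain ⟨p, hp, rfl⟩ := hy'
  obtain ⟨φ₁, θ₁, hθ₁, rfl⟩ := hM p hp
  obtain ⟨φ₂, θ₂, hθ₂, hm⟩ := hM _ ((hψ.bijOn t ht).mapsTo hp)
  -- Two parametrizations of `S` around the same point. `X₁ = x ∘ φ₁` carries the metric `g(t)` and
  -- turns `z` into `φ₂ ∘ Ψ`; `X₂ = x̂ ∘ φ₂` turns `z` into `φ₂`.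
  set X₁ := φ₁.pushforward (x t) hx2 (hx.injOn ht) hc (hx.immersion t ht φ₁) hSx with hX₁
  set X₂ := φ₂.pushforward _ hh2 hhinj hc (hhimm φ₂) hS with hX₂
  have hX₁y : X₁.map θ₁ = x t (φ₁.map θ₁) := rfl
  have hX₂y : X₂.map θ₂ = x t (φ₁.map θ₁) := by
    change deTurckFlow M x ψ t (φ₂.map θ₂) = _
    rw [hm, hψ.deTurckFlow_apply ht hp]
  have hzy : z (x t (φ₁.map θ₁)) = φ₂.map θ₂ := by
    rw [← hX₂y]
    exact hzh _ (φ₂.map_mem hθ₂)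
  have hzX₂ : z ∘ X₂.map =ᶠ[𝓝 θ₂] φ₂.map := by
    filter_upwards [φ₂.isOpen_dom.mem_nhds hθ₂] with θ hθ using hzh _ (φ₂.map_mem hθ)
  have hνy := hν _ hy
  set N := ν (x t (φ₁.map θ₁)) with hN
  have hνX₂ : IsUnitNormalAt S (X₂.map θ₂) (ν (X₂.map θ₂)) := by rw [hX₂y]; exact hνy
  have hzdX₂ : DifferentiableWithinAt ℝ z S (X₂.map θ₂) := by rw [hX₂y]; exact hzd _ hy
  have hφ₂2 : ContDiffAt ℝ 2 φ₂.map θ₂ := (φ₂.contDiffAt hθ₂).of_le two_le_infty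
  -- the mean curvature vector
  have hL : surfaceLaplacian S ν (fun y => y) (x t (φ₁.map θ₁))
      = -(meanCurvature (x t ∘ φ₁.map) N θ₁ • N) :=
    (X₁.surfaceLaplacian_map le_rfl hν contDiffOn_id hθ₁).trans
      (laplaceCoord_self (X₁.contDiffAt hθ₁) (X₁.injective_fderiv _ hθ₁) hνy.1
        (IsUnitNormalAt.inner_pd (X := X₁) hνy (by norm_num) hθ₁))
  have hev : derivWithin (fun s => x s (φ₁.map θ₁)) (Ico 0 T) t
      = surfaceLaplacian S ν (fun y => y) (x t (φ₁.map θ₁)) := by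
    rw [hL]
    exact hx.evolution t ht φ₁ θ₁ hθ₁ N (hSx ▸ hνy)
  -- the harmonic map heat flow in coordinates
  set Ψ : Coord n → Coord n := fun θ' => φ₂.chart (ψ t (φ₁.map θ')) with hΨ
  have hchart : ContDiffWithinAt ℝ 2 φ₂.chart M (ψ t (φ₁.map θ₁)) := by
    rw [← hm]
    exact (φ₂.contDiffWithinAt_chart (by simp) hθ₂).of_le two_le_infty
  have himage : φ₂.map '' φ₂.dom ∈ 𝓝[M] (ψ t (φ₁.map θ₁)) := by
    rw [← hm]
    exact φ₂.image_dom_mem_nhdsWithin hθ₂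
  have hψφ : ContDiffAt ℝ 2 (ψ t ∘ φ₁.map) θ₁ := φ₁.contDiffAt_comp two_le_infty hψ2 hθ₁
  have hmaps : MapsTo (ψ t ∘ φ₁.map) φ₁.dom M := fun θ hθ =>
    (hψ.bijOn t ht).mapsTo (φ₁.map_mem hθ)
  have hΨ2 : ContDiffAt ℝ 2 Ψ θ₁ :=
    (hchart.comp θ₁ hψφ.contDiffWithinAt hmaps).contDiffAt (φ₁.isOpen_dom.mem_nhds hθ₁)
  have hΨθ : Ψ θ₁ = θ₂ := by
    simp only [hΨ, ← hm]
    exact φ₂.chart_map hθ₂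
  have hzX₁ : z ∘ X₁.map =ᶠ[𝓝 θ₁] fun θ' => φ₂.map (Ψ θ') := by
    have h1 : Tendsto (ψ t ∘ φ₁.map) (𝓝 θ₁) (𝓝[M] (ψ t (φ₁.map θ₁))) :=
      tendsto_nhdsWithin_iff.2 ⟨hψφ.continuousAt, by
        filter_upwards [φ₁.isOpen_dom.mem_nhds hθ₁] with θ' h using hmaps h⟩
    filter_upwards [h1 himage, φ₁.isOpen_dom.mem_nhds hθ₁] with θ' h h'
    change z (x t (φ₁.map θ')) = φ₂.map (φ₂.chart (ψ t (φ₁.map θ')))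
    rw [φ₂.map_chart (y := ψ t (φ₁.map θ')) h, ← hψ.deTurckFlow_apply ht (φ₁.map_mem h'),
      hzh (ψ t (φ₁.map θ')) (hmaps h')]
  set V : Coord n := WithLp.toLp 2 fun q =>
    mapLaplaceCoord (inducedMetric (x t ∘ φ₁.map)) (inducedMetric φ₂.map) Ψ q θ₁ with hV
  -- `Δ_S z` and the pushforward of the map Laplacian `V` differ by a vector normal to `M`.
  have hW : ∀ l, inner ℝ (surfaceLaplacian S ν z (x t (φ₁.map θ₁)) - fderiv ℝ φ₂.map θ₂ V)
      (pd l φ₂.map θ₂) = 0 := by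
    intro l
    have h1 : surfaceLaplacian S ν z (x t (φ₁.map θ₁))
        = laplaceCoord (inducedMetric (x t ∘ φ₁.map)) (fun θ' => φ₂.map (Ψ θ')) θ₁ :=
      (X₁.surfaceLaplacian_map le_rfl hν hz2 hθ₁).trans (laplaceCoord_congr _ hzX₁)
    have h2 := inner_laplaceCoord_comp (Y := φ₂.map) (by rw [hΨθ]; exact hφ₂2)
      (by rw [hΨθ]; exact φ₂.injective_fderiv _ hθ₂) hΨ2 (inducedMetric (x t ∘ φ₁.map)) l
    rw [hΨθ] at h2
    rw [inner_sub_left, h1, h2, fderiv_eq_sum_pd, sub_self]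
  -- the time derivatives
  set c : ℝ → Coord n := fun s => φ₂.chart (ψ s (φ₁.map θ₁)) with hcdef
  have huniq : UniqueDiffWithinAt ℝ (Ico 0 T) t := uniqueDiffOn_Ico 0 T t ht
  have hψs : ContDiffWithinAt ℝ 2 (fun s => ψ s (φ₁.map θ₁)) (Ico 0 T) t :=
    (hψ.contDiffOn.comp (f := fun s : ℝ => (s, φ₁.map θ₁))
      (contDiff_prodMk_left _).contDiffOn fun s hs => ⟨hs, hp⟩) t ht
  have hψsM : MapsTo (fun s => ψ s (φ₁.map θ₁)) (Ico 0 T) M := fun s hs =>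
    (hψ.bijOn s hs).mapsTo hp
  have hcd : DifferentiableWithinAt ℝ c (Ico 0 T) t :=
    (hchart.comp t hψs hψsM).differentiableWithinAt (by norm_num)
  have hct : c t = θ₂ := hΨθ
  have hc' : HasDerivWithinAt c (α⁻¹ • V) (Ico 0 T) t := by
    have h := hcd.hasDerivWithinAt
    have hd : derivWithin c (Ico 0 T) t = α⁻¹ • V := by
      ext q
      have hq := (EuclideanSpace.proj q : Coord n →L[ℝ] ℝ).hasFDerivAt.comp_hasDerivWithinAt t h
      have h3 := hψ.evolution t ht φ₁ φ₂ θ₁ hθ₁ (hm ▸ mem_image_of_mem _ hθ₂) q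
      rw [one_div] at h3
      exact (hq.derivWithin huniq).symm.trans h3
    rw [← hd]
    exact h
  have hG : DifferentiableWithinAt ℝ (fun q : ℝ × Coord n => deTurckFlow M x ψ q.1 (φ₂.map q.2))
      (Ico 0 T ×ˢ φ₂.dom) (t, θ₂) := by
    have h := (hψ.contDiffOn_deTurckFlow hx).comp
      (f := fun q : ℝ × Coord n => (q.1, φ₂.map q.2)) (s := Ico 0 T ×ˢ φ₂.dom)
      (contDiffOn_fst.prodMk ((φ₂.contDiffOn.of_le two_le_infty).comp contDiffOn_snd
        fun q hq => hq.2)) fun q hq => ⟨hq.1, φ₂.map_mem hq.2⟩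
    exact h.differentiableOn (by norm_num) _ ⟨ht, hθ₂⟩
  -- One joint derivative of `x̂` in time and parameter: `G'(1, 0)` is the velocity of `x̂` and
  -- `G'(0, ·)` the derivative of `X₂`. Along the curve `(s, c s)`, where `x̂` becomes `x`, it gives
  -- the velocity of `x`; derivatives in time are taken within `[0, T)`, hence one-sided at `0`.
  obtain ⟨G', hG'⟩ := hG
  have hdu : HasDerivWithinAt (fun s => deTurckFlow M x ψ s (φ₂.map θ₂)) (G' (1, 0))
      (Ico 0 T) t :=
    hG'.comp_hasDerivWithinAt (f := fun s : ℝ => (s, θ₂)) t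
      ((hasDerivWithinAt_id t _).prodMk (hasDerivWithinAt_const t _ θ₂)) fun s hs => ⟨hs, hθ₂⟩
  have hspace : HasFDerivAt X₂.map (G'.comp (ContinuousLinearMap.inr ℝ ℝ (Coord n))) θ₂ :=
    (hG'.comp (f := fun θ : Coord n => (t, θ)) θ₂
      (hasFDerivAt_prodMk_right t θ₂).hasFDerivWithinAt (s := φ₂.dom)
      fun θ hθ => ⟨ht, hθ⟩).hasFDerivAt (φ₂.isOpen_dom.mem_nhds hθ₂)
  have hcdom : ∀ᶠ s in 𝓝[Ico 0 T] t, φ₂.map (c s) = ψ s (φ₁.map θ₁) ∧ c s ∈ φ₂.dom := by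
    have h1 : Tendsto (fun s => ψ s (φ₁.map θ₁)) (𝓝[Ico 0 T] t) (𝓝[M] (ψ t (φ₁.map θ₁))) :=
      tendsto_nhdsWithin_iff.2 ⟨hψs.continuousWithinAt, eventually_mem_nhdsWithin.mono hψsM⟩
    filter_upwards [h1 himage] with s h
    exact ⟨φ₂.map_chart h, φ₂.chart_mem h⟩
  have htot : HasDerivWithinAt (fun s => x s (φ₁.map θ₁)) (G' (1, α⁻¹ • V)) (Ico 0 T) t := by
    have hst : Tendsto (fun s => (s, c s)) (𝓝[Ico 0 T] t) (𝓝[Ico 0 T ×ˢ φ₂.dom] (t, c t)) :=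
      tendsto_nhdsWithin_iff.2 ⟨continuousWithinAt_id.prodMk hcd.continuousWithinAt, by
        filter_upwards [hcdom, eventually_mem_nhdsWithin] with s h h' using ⟨h', h.2⟩⟩
    have h1 : HasFDerivWithinAt
        (fun q : ℝ × Coord n => deTurckFlow M x ψ q.1 (φ₂.map q.2)) G'
        (Ico 0 T ×ˢ φ₂.dom) (t, c t) := by rw [hct]; exact hG'
    have h2 : HasDerivWithinAt (fun s => (s, c s)) (1, α⁻¹ • V) (Ico 0 T) t :=
      (hasDerivWithinAt_id t _).prodMk hc'
    have h3 := (h1.comp_of_tendsto t h2.hasFDerivWithinAt hst).hasDerivWithinAt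
    simp only [ContinuousLinearMap.comp_apply, ContinuousLinearMap.toSpanSingleton_apply,
      one_smul] at h3
    refine h3.congr_of_eventuallyEq_of_mem ?_ ht
    filter_upwards [hcdom, eventually_mem_nhdsWithin] with s h h'
    simp only [Function.comp_apply]
    rw [h.1, hψ.deTurckFlow_apply h' hp]
  set τ : Amb n := fderiv ℝ X₂.map θ₂ V with hτ
  have hντ : inner ℝ N τ = 0 := by
    have h := hνX₂.2 _ (X₂.fderiv_mem_tangentConeAt (by norm_num) hθ₂ V)
    rw [hX₂y] at h
    exact h
  have hunit : IsUnit (metricRep S ν z (x t (φ₁.map θ₁))).det := by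
    rw [← hX₂y]
    refine X₂.isUnit_det_metricRep (by norm_num) hθ₂ hνX₂ hzdX₂ ?_
    rw [hzX₂.fderiv_eq]
    exact φ₂.injective_fderiv _ hθ₂
  rw [hzy]
  refine ⟨hdu.differentiableWithinAt, hunit, ?_, τ, hντ, ?_, ?_⟩
  · rw [hL, inner_neg_left, inner_smul_left, real_inner_self_eq_norm_sq, hνy.1]
    simp
  · rw [← hev, htot.derivWithin huniq, hdu.derivWithin huniq, hτ, hspace.fderiv,
      ContinuousLinearMap.comp_apply, ← map_smul, ← map_add]
    simp
  · have hAτ : tangentialGradient S ν z (x t (φ₁.map θ₁)) *ᵥ τ.ofLp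
        = (fderiv ℝ φ₂.map θ₂ V).ofLp := by
      rw [tangentialGradient_mulVec, hντ, zero_smul, sub_zero, hτ, ← hX₂y,
        X₂.fderivWithin_apply_fderiv (by norm_num) hθ₂ hzdX₂, hzX₂.fderiv_eq]
    have hsub := X₂.transpose_tangentialGradient_mulVec_eq_zero (by norm_num) hθ₂ hνX₂ hzdX₂
      (D := surfaceLaplacian S ν z (x t (φ₁.map θ₁)) - fderiv ℝ φ₂.map θ₂ V) fun j => by
        rw [pd_congr hzX₂]
        exact hW j
    -- Now `(∇_S z)ᵀ ∇_S z τ = (∇_S z)ᵀ Δ_S z`, and the `ν ⊗ ν` part of `Ĥ` does not act on the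
    -- tangential `τ`.
    rw [hX₂y, WithLp.ofLp_sub, Matrix.mulVec_sub, sub_eq_zero] at hsub
    have hντ' : N.ofLp ⬝ᵥ τ.ofLp = 0 := by
      rw [← hντ]
      simp [PiLp.inner_apply, dotProduct, mul_comm]
    rw [metricRep, Matrix.add_mulVec, ← Matrix.mulVec_mulVec, hAτ, hsub,
      Matrix.vecMulVec_mulVec, ← hN, hντ']
    simp

/-! ### The weak formulation -/

theorem mainTheorem5 (n : ℕ) (α T : ℝ) (hα : 0 < α)
    (M : Set (Amb n)) (hM : IsHypersurface n ∞ M) (hMcompact : IsCompact M)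
    (hMconn : IsConnected M)
    (x ψ : ℝ → Amb n → Amb n)
    (hx : IsMeanCurvatureFlow M T x) (hψ : IsHarmonicMapHeatFlow M T α x ψ)
    -- the mean curvature-DeTurck flow, and the moving hypersurface
    (xhat : ℝ → Amb n → Amb n) (hxhat : xhat = deTurckFlow M x ψ)
    (Γ : ℝ → Set (Amb n)) (hΓ : ∀ t, Γ t = xhat t '' M)
    -- a unit normal field on the moving hypersurface
    (ν : ℝ → Amb n → Amb n) (hν : ∀ t ∈ Ico 0 T, ∀ y ∈ Γ t, IsUnitNormalAt (Γ t) y (ν t y))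
    -- the inverse of `xhat t : M → Γ t`
    (z : ℝ → Amb n → Amb n) (hz : ∀ t, z t = Function.invFunOn (xhat t) M)
    -- the field `w = v ∘ xhat⁻¹`, where `v` is the Laplacian of the identity map of `M`
    (w : ℝ → Amb n → Amb n) (hw : ∀ t y, w t y = laplacian M (xhat t) id (z t y))
    -- the identity map on the moving hypersurface and its material derivative
    (u du : ℝ → Amb n → Amb n) (hu : ∀ t y, u t y = y) (hdu : du = materialDeriv M T xhat u)
    (t : ℝ) (ht : t ∈ Ico 0 T) :
    -- the quantities in the weak formulation are well defined
    (∀ y ∈ Γ t,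
      DifferentiableWithinAt ℝ (fun s => u s (xhat s (z t y))) (Ico 0 T) t ∧
      DifferentiableWithinAt ℝ (z t) (Γ t) y ∧
      IsUnit (metricRep (Γ t) (ν t) (z t) y).det) ∧
    -- the first equation
    (∀ (η : Amb n → Amb n) (Dη : Amb n → Matrix (Fin (n + 1)) (Fin (n + 1)) ℝ),
      IsSobolevH12 (Γ t) (ν t) η Dη →
      Integrable (fun y => inner ℝ (du t y) (η y)) (surfaceMeasure (Γ t)) ∧
      Integrable (fun y => inner ℝ (du t y) (ν t y) * inner ℝ (ν t y) (η y))
        (surfaceMeasure (Γ t)) ∧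
      Integrable (fun y => frobProd (tangentialGradient (Γ t) (ν t) (u t) y) (Dη y))
        (surfaceMeasure (Γ t)) ∧
      Integrable (fun y => (w t y).ofLp ⬝ᵥ (tangentialGradient (Γ t) (ν t) (z t) y *ᵥ
          ((metricRep (Γ t) (ν t) (z t) y)⁻¹ *ᵥ (η y).ofLp))) (surfaceMeasure (Γ t)) ∧
      0 = α * ∫ y, inner ℝ (du t y) (η y) ∂(surfaceMeasure (Γ t))
        + (1 - α) * ∫ y, inner ℝ (du t y) (ν t y) * inner ℝ (ν t y) (η y)
            ∂(surfaceMeasure (Γ t))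
        + ∫ y, frobProd (tangentialGradient (Γ t) (ν t) (u t) y) (Dη y) ∂(surfaceMeasure (Γ t))
        + ∫ y, (w t y).ofLp ⬝ᵥ (tangentialGradient (Γ t) (ν t) (z t) y *ᵥ
            ((metricRep (Γ t) (ν t) (z t) y)⁻¹ *ᵥ (η y).ofLp)) ∂(surfaceMeasure (Γ t))) ∧
    -- the second equation
    (∀ (ζ : Amb n → Amb n) (Dζ : Amb n → Matrix (Fin (n + 1)) (Fin (n + 1)) ℝ),
      IsSobolevH12 (Γ t) (ν t) ζ Dζ →
      Integrable (fun y => inner ℝ (w t y) (ζ y)) (surfaceMeasure (Γ t)) ∧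
      Integrable (fun y => frobProd (tangentialGradient (Γ t) (ν t) (z t) y) (Dζ y))
        (surfaceMeasure (Γ t)) ∧
      0 = ∫ y, inner ℝ (w t y) (ζ y) ∂(surfaceMeasure (Γ t))
        + ∫ y, frobProd (tangentialGradient (Γ t) (ν t) (z t) y) (Dζ y)
            ∂(surfaceMeasure (Γ t))) := by
  subst hxhat hdu
  obtain rfl : Γ = fun t => deTurckFlow M x ψ t '' M := funext hΓ
  obtain rfl : z = fun t => Function.invFunOn (deTurckFlow M x ψ t) M := funext hz
  obtain rfl : u = fun _ y => y := funext fun t => funext fun y => hu t y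
  have hν := hν t ht
  have hh2 := (hψ.contDiffOn_deTurckFlow hx).slice ht
  have hhinj := hψ.injOn_deTurckFlow hx ht
  have hhimm := hψ.injective_fderiv_deTurckFlow hM hx ht
  have hz2 := contDiffOn_invFunOn_image hM hMcompact hh2 hhinj hhimm
  have hS := hM.image hMcompact hh2 hhinj hhimm
  have hSc := hMcompact.image_of_continuousOn hh2.continuousOn
  have key := fun y hy => deTurckFlow_equation hM hMcompact hx hψ ht rfl hν rfl (y := y) hy
  have hw' : ∀ y ∈ deTurckFlow M x ψ t '' M, w t y = surfaceLaplacian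
      (deTurckFlow M x ψ t '' M) (ν t) (Function.invFunOn (deTurckFlow M x ψ t) M) y := by
    rintro _ ⟨p, hp, rfl⟩
    rw [hw]
    beta_reduce
    rw [hhinj.leftInvOn_invFunOn hp]
    exact laplacian_id_eq_surfaceLaplacian hM hMcompact hh2 hhinj hhimm hν hp
  clear hΓ hz hu
  beta_reduce at *
  set S := deTurckFlow M x ψ t '' M with hSdef
  set z := Function.invFunOn (deTurckFlow M x ψ t) M with hzdef
  set N := ν t with hN
  have hfin := hS.isFiniteMeasure (by norm_num) hSc
  have hzd := hz2.differentiableOn (by norm_num)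
  have hae : ∀ {P : Amb n → Prop}, (∀ y ∈ S, P y) → ∀ᵐ y ∂(surfaceMeasure S), P y :=
    fun h => ae_restrict_of_forall_mem hSc.measurableSet h
  have hz1 : ContDiffOn ℝ 1 z S := hz2.of_le (by norm_num)
  have hLu := hS.continuousOn_surfaceLaplacian le_rfl hν (f := fun y => y) contDiffOn_id
  have hLz := hS.continuousOn_surfaceLaplacian le_rfl hν hz2
  have hAu := hS.continuousOn_tangentialGradient (by norm_num) hν (f := fun y => y) contDiffOn_id
  have hAz := hS.continuousOn_tangentialGradient (by norm_num) hν hz1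
  refine ⟨fun y hy => ⟨(key y hy).1, hzd y hy, (key y hy).2.1⟩, ?_, ?_⟩
  · intro η Dη hη
    -- The pointwise `τ` solves `Ĥ τ = (∇_S z)ᵀ Δ_S z`; solving for it gives a formula from which
    -- continuity on `S` is visible.
    set τ : Amb n → Amb n := fun y => WithLp.toLp 2 ((metricRep S N z y)⁻¹ *ᵥ
      ((tangentialGradient S N z y)ᵀ *ᵥ (surfaceLaplacian S N z y).ofLp)) with hτ
    have hτc : ContinuousOn τ S := by
      have h1 : ContinuousOn (fun y => (metricRep S N z y)⁻¹) S := fun y hy =>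
        ContinuousWithinAt.matrix_inv (hS.continuousOn_metricRep (by norm_num) hν hz1 y hy)
          (key y hy).2.1
      have h2 : ContinuousOn (fun y => (tangentialGradient S N z y)ᵀ *ᵥ
          (surfaceLaplacian S N z y).ofLp) S :=
        (Continuous.matrix_mulVec continuous_fst.matrix_transpose
          ((PiLp.continuous_ofLp 2 _).comp continuous_snd)).comp_continuousOn (hAz.prodMk hLz)
      exact (PiLp.continuous_toLp 2 _).comp_continuousOn
        ((Continuous.matrix_mulVec continuous_fst continuous_snd).comp_continuousOn
          (h1.prodMk h2))
    have hpt : ∀ y ∈ S, inner ℝ (N y) (τ y) = 0 ∧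
        materialDeriv M T (deTurckFlow M x ψ) (fun _ y => y) t y
          = surfaceLaplacian S N (fun y => y) y - α⁻¹ • τ y := by
      intro y hy
      obtain ⟨-, hu, -, τ', h1, h2, h3⟩ := key y hy
      have e : τ y = τ' := by
        simp only [hτ]
        rw [← h3, Matrix.mulVec_mulVec, Matrix.nonsing_inv_mul _ hu, Matrix.one_mulVec]
      rw [e]
      exact ⟨h1, eq_sub_of_add_eq h2.symm⟩
    have e1 : (fun y => inner ℝ (materialDeriv M T (deTurckFlow M x ψ) (fun _ y => y) t y) (η y))
        =ᵐ[surfaceMeasure S] fun y => inner ℝ (surfaceLaplacian S N (fun y => y) y) (η y)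
          - α⁻¹ * inner ℝ (τ y) (η y) := hae fun y hy => by
      beta_reduce
      rw [(hpt y hy).2, inner_sub_left, inner_smul_left]
      simp
    -- The normal part of the velocity is all of `Δ_S id`. The two factors of `ν` disappear, so
    -- integrability needs no regularity of `ν`.
    have e2 : (fun y => inner ℝ (materialDeriv M T (deTurckFlow M x ψ) (fun _ y => y) t y) (N y)
          * inner ℝ (N y) (η y))
        =ᵐ[surfaceMeasure S] fun y => inner ℝ (surfaceLaplacian S N (fun y => y) y) (η y) :=
      hae fun y hy => by
        beta_reduce
        rw [(hpt y hy).2, inner_sub_left, inner_smul_left, real_inner_comm (N y) (τ y),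
          (hpt y hy).1, mul_zero, sub_zero]
        conv_rhs => rw [(key y hy).2.2.1, inner_smul_left]
        simp
    -- Transposition moves `∇_S z` and the symmetric `Ĥ⁻¹` onto `w`, which produces `τ`.
    have e4 : (fun y => (w t y).ofLp ⬝ᵥ (tangentialGradient S N z y *ᵥ
          ((metricRep S N z y)⁻¹ *ᵥ (η y).ofLp)))
        =ᵐ[surfaceMeasure S] fun y => inner ℝ (τ y) (η y) := hae fun y hy => by
      have hT : ((metricRep S N z y)⁻¹)ᵀ = (metricRep S N z y)⁻¹ := by
        rw [Matrix.transpose_nonsing_inv, metricRep_isSymm]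
      beta_reduce
      rw [hw' y hy, Matrix.dotProduct_mulVec, Matrix.dotProduct_mulVec,
        ← Matrix.mulVec_transpose, ← Matrix.mulVec_transpose, hT]
      simp [hτ, PiLp.inner_apply, dotProduct, mul_comm]
    have i1 := hη.integrable_inner hSc hLu
    have i2 := hη.integrable_inner hSc hτc
    have i3 := hη.integrable_frobProd hSc hAu
    have green := hη.integral_surfaceLaplacian hS le_rfl hSc hν (f := fun y => y) contDiffOn_id
    refine ⟨(i1.sub (i2.const_mul α⁻¹)).congr e1.symm, i1.congr e2.symm, i3, i2.congr e4.symm, ?_⟩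
    rw [integral_congr_ae e1, integral_congr_ae e2, integral_congr_ae e4,
      integral_sub i1 (i2.const_mul _), integral_const_mul]
    have hα' : α * α⁻¹ = 1 := mul_inv_cancel₀ hα.ne'
    -- The multiples of `∫ Δ_S id · η` add up to one, and the `τ` terms cancel because `α α⁻¹ = 1`.
    linear_combination -green + hα' * ∫ y, inner ℝ (τ y) (η y) ∂(surfaceMeasure S)
  · intro ζ Dζ hζ
    have e : (fun y => inner ℝ (w t y) (ζ y)) =ᵐ[surfaceMeasure S]
        fun y => inner ℝ (surfaceLaplacian S N z y) (ζ y) := hae fun y hy => by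
      beta_reduce
      rw [hw' y hy]
    refine ⟨(hζ.integrable_inner hSc hLz).congr e.symm, hζ.integrable_frobProd hSc hAz, ?_⟩
    rw [integral_congr_ae e]
    exact (hζ.integral_surfaceLaplacian hS le_rfl hSc hν hz2).symm
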